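/- Let $N_-,N_+\ge 1$, $N=N_-+N_+$, and $k_1<k_2<\dots<k_N$ real. For $\theta^0=(\theta_1^0,\dots,\theta_N^0)\in\mathbb R^N$ put $\theta_i(x,y,t)=-k_ix+k_i^2y-k_i^3t+\theta_i^0$ and $f=\sum_{i=1}^N e^{\theta_i}$, and let $$\tau_{N_+}=\det\big(\partial_x^{a+b}f\big)_{0\le a,b\le N_+-1},\qquad u=2\,\partial_x^2\log\tau_{N_+}$$ be the $(N_-,N_+)$-soliton solution of the KP equation. The function $\tau_{N_+}$ is a combination, with positive coefficients depending only on $k$, of the exponentials $\exp\big(\sum_{i\in I}\theta_i\big)$, where $I$ runs over the subsets of $\{1,\dots,N\}$ with $N_+$ elements. Such an exponential is called dominant at a point if $\sum_{i\in I}\theta_i$ is the largest of all these sums there. The graph of the solution at the time $t$ is the set of those points of the $x$-$y$ plane at which at least two of the exponentials are dominant; it consists of pieces of the lines $\theta_i=\theta_j$. A hole is a bounded connected component of the complement of the graph. The situation is called generic, for given $\theta^0$ and $t$, if at no point of the plane more than three exponentials are dominant (so that all vertices of the graph are Y-shaped). Then: 1. A point $(x,y)$ lies on the graph for $\theta^0$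 and $t$ if and only if $u_{s\theta^0}(sx,sy,st)$ does not tend to $0$ as $s\to\infty$, where $u_{s\theta^0}$ denotes the solution with the phase constants $s\theta_i^0$. 2. For every $\theta^0$ the situation is generic for all but finitely many $t$; for every $t$ it is generic for Lebesgue-almost every $\theta^0$. 3. In the generic situation the graph has exactly $(N_--1)(N_+-1)$ holes. In particular, for $N_-=N_+=n$ there are $(n-1)^2$ holes. -/

import Mathlib

open scoped Topology

noncomputable section

namespace KPSoliton

/-- The phase `θ_i = -k_i x + k_i² y - k_i³ t + θ_i⁰` at the point `p = (x, y)` and the time `t`. -/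
def phase {N : ℕ} (k θ₀ : Fin N → ℝ) (t : ℝ) (p : ℝ × ℝ) (i : Fin N) : ℝ :=
  -k i * p.1 + k i ^ 2 * p.2 - k i ^ 3 * t + θ₀ i

/-- The function `f = ∑ i, exp θ_i`. -/
def expSum {N : ℕ} (k θ₀ : Fin N → ℝ) (t : ℝ) (p : ℝ × ℝ) : ℝ :=
  ∑ i, Real.exp (phase k θ₀ t p i)

/-- The tau-function `τ_M`: the `M × M` Hankel determinant with entries `∂^(a+b) f / ∂x^(a+b)`,
`0 ≤ a, b ≤ M - 1`. -/
def tau {N : ℕ} (M : ℕ) (k θ₀ : Fin N → ℝ) (t : ℝ) (p : ℝ × ℝ) : ℝ :=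
  Matrix.det (Matrix.of fun a b : Fin M =>
    iteratedDeriv ((a : ℕ) + (b : ℕ)) (fun x => expSum k θ₀ t (x, p.2)) p.1)

/-- The solution `u = 2 ∂²/∂x² log τ_M` of the KP equation; for `N = N₋ + N₊` and `M = N₊` this is
the `(N₋, N₊)`-soliton solution. -/
def solution {N : ℕ} (M : ℕ) (k θ₀ : Fin N → ℝ) (t : ℝ) (p : ℝ × ℝ) : ℝ :=
  2 * iteratedDeriv 2 (fun x => Real.log (tau M k θ₀ t (x, p.2))) p.1

/-- The index sets `I` with `M` elements whose exponential `exp (∑ i ∈ I, θ_i)` is dominant at the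
point `p`, that is, largest among all exponentials with `M` phases (these are the exponentials
that occur in `τ_M`). -/
def dominant {N : ℕ} (M : ℕ) (k θ₀ : Fin N → ℝ) (t : ℝ) (p : ℝ × ℝ) : Set (Finset (Fin N)) :=
  {I | I.card = M ∧ ∀ J : Finset (Fin N), J.card = M →
    ∑ j ∈ J, phase k θ₀ t p j ≤ ∑ i ∈ I, phase k θ₀ t p i}

/-- The graph of the soliton solution in the `x`-`y` plane at the time `t`: the points at which
at least two exponentials are in dominant balance. It consists of pieces of the lines
`θ_i = θ_j` (line solitons). -/
def graph {N : ℕ} (M : ℕ) (k θ₀ : Fin N → ℝ) (t : ℝ) : Set (ℝ × ℝ) :=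
  {p | (dominant M k θ₀ t p).Nontrivial}

/-- The generic situation: at no point are more than three exponentials in dominant balance
(all vertices of the graph are Y-shaped). -/
def IsGeneric {N : ℕ} (M : ℕ) (k θ₀ : Fin N → ℝ) (t : ℝ) : Prop :=
  ∀ p : ℝ × ℝ, (dominant M k θ₀ t p).encard ≤ 3

/-- The holes of a plane set `G`: the bounded connected components of its complement. -/
def holes (G : Set (ℝ × ℝ)) : Set (Set (ℝ × ℝ)) :=
  {C | (∃ p ∈ Gᶜ, C = connectedComponentIn Gᶜ p) ∧ Bornology.IsBounded C}

end KPSoliton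

end

/-! The graph as the visible set. Expanding the Hankel determinant by a symmetrized Cauchy–Binet
formula (`det_moments`, `tau_eq`) writes the tau-function as a sum of exponentials whose
coefficients are squared Vandermonde determinants. Hence `u` is twice the variance of the wave
numbers `∑ i ∈ I, k i`, weighted by the exponentials. Under scaling only the dominant exponentials
keep their weight, so the limit is zero exactly if all dominant sets have the same wave number. If
there are two dominant sets, exchanging one tied index produces two whose wave numbers differ by
some `k j - k i ≠ 0` (`mem_graph_iff_not_tendsto`).

Genericity. More than three dominant sets force four phases to agree at a point. The third divided
difference of `θ₀` at the four wave numbers then equals `t` (`dividedDiff_eq_time`). This leaves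
finitely many times for given `θ₀`, and finitely many hyperplanes of phase constants for given `t`.

Holes. The complement of the graph is the disjoint union of the open convex regions belonging to the
index sets `I`, so holes are the non-empty bounded regions. In a fixed direction the slope of the
phase is a quadratic in `k`, concave when the direction points down and convex when it points up.
Therefore a region is bounded if and only if neither `I` nor `Iᶜ` is contiguous
(`isBounded_region_iff`). A non-empty region with `I` not contiguous has a lowest point. In the
generic situation this is a vertex of three phases `i < j < l` lying below exactly `M - 2` others,
and it determines `I`, which consists of those others together with `i` and `l` (`encard_bornSets`).

It remains to count such vertices (`card_triplesOfDepth`). Upwards along the line where phases `i`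
and `j` agree, the number of larger phases changes by one at each crossing with a third phase `m`:
up if `m` lies outside the interval from `i` to `j`, down if inside. A signed sum over the crossings
telescopes to data at the two ends of the line. Summed over all pairs, each triple contributes with
signs `1 + 1 - 1 = 1`. With `N = D + M` this gives `(M - 1) * D` vertices. Among the corresponding
sets, `M - 1` have a contiguous complement and thus an unbounded region, leaving `(M - 1) * (D - 1)`
holes. -/

noncomputable section

namespace KPSoliton

/-! ### Logarithmic derivatives and limits of sums of exponentials -/

section Exponentials

variable {ι : Type*}

/-- The variance formula for `∂² log τ` of a sum of exponentials: the second derivative of the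
logarithm of `∑ c g * exp (b g - K g * x)`. -/
theorem iteratedDeriv_two_log_sum_exp [Fintype ι] [Nonempty ι] (c K b : ι → ℝ) (hc : ∀ g, 0 < c g) (x : ℝ) :
    iteratedDeriv 2 (fun x => Real.log (∑ g, c g * Real.exp (b g - K g * x))) x =
      (∑ g, c g * K g ^ 2 * Real.exp (b g - K g * x)) / (∑ g, c g * Real.exp (b g - K g * x)) -
      ((∑ g, c g * K g * Real.exp (b g - K g * x)) /
        (∑ g, c g * Real.exp (b g - K g * x))) ^ 2 := by
  have hpos : ∀ x, 0 < ∑ g, c g * Real.exp (b g - K g * x) := fun x =>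
    Finset.sum_pos (fun g _ => mul_pos (hc g) (Real.exp_pos _)) Finset.univ_nonempty
  have hexp : ∀ (a : ι → ℝ) (x : ℝ), HasDerivAt (fun x => ∑ g, a g * Real.exp (b g - K g * x))
      (-∑ g, a g * K g * Real.exp (b g - K g * x)) x := by
    intro a x
    rw [← Finset.sum_neg_distrib]
    refine HasDerivAt.fun_sum fun g _ => ?_
    have h := ((((hasDerivAt_id x).const_mul (K g)).const_sub (b g)).exp).const_mul (a g)
    refine h.congr_deriv ?_
    simp only [id_eq]; ring
  have h1 : deriv (fun x => Real.log (∑ g, c g * Real.exp (b g - K g * x))) =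
      fun x => (-∑ g, c g * K g * Real.exp (b g - K g * x)) /
        (∑ g, c g * Real.exp (b g - K g * x)) := by
    funext x
    exact ((hexp c x).log (hpos x).ne').deriv
  rw [iteratedDeriv_succ, iteratedDeriv_one, h1]
  have h2 := ((hexp (fun g => c g * K g) x).neg.div (hexp c x) (hpos x).ne').deriv
  simp only [Pi.neg_apply] at h2
  refine Eq.trans h2 ?_
  have h3 : ∑ g, c g * K g ^ 2 * Real.exp (b g - K g * x) =
      ∑ g, c g * K g * K g * Real.exp (b g - K g * x) :=
    Finset.sum_congr rfl fun g _ => by ring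
  rw [h3]
  rw [div_pow, div_sub_div _ _ (hpos x).ne' (pow_ne_zero 2 (hpos x).ne'),
    div_eq_div_iff (pow_ne_zero 2 (hpos x).ne')
      (mul_ne_zero (hpos x).ne' (pow_ne_zero 2 (hpos x).ne'))]
  generalize ∑ g, c g * Real.exp (b g - K g * x) = A
  generalize ∑ g, c g * K g * Real.exp (b g - K g * x) = B
  generalize ∑ g, c g * K g * K g * Real.exp (b g - K g * x) = C
  ring

/-- In a sum of exponentials with common rate `s → ∞`, divided by the largest exponential, only
the dominant terms survive. -/
theorem tendsto_sum_mul_exp [Fintype ι] (a Θ : ι → ℝ) (v : ℝ) (hv : ∀ g, Θ g ≤ v) :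
    Filter.Tendsto (fun s : ℝ => ∑ g, a g * Real.exp (s * (Θ g - v))) Filter.atTop
      (𝓝 (∑ g with Θ g = v, a g)) := by
  classical
  rw [Finset.sum_filter]
  refine tendsto_finsetSum _ fun g _ => ?_
  split_ifs with h
  · simp [h]
  · have hlt : Θ g - v < 0 := sub_neg.2 (lt_of_le_of_ne (hv g) h)
    have := (Real.tendsto_exp_atBot.comp
      ((Filter.tendsto_id.atTop_mul_const_of_neg hlt))).const_mul (a g)
    simpa using this

/-- A positively weighted variance vanishes only if the values agree. -/
theorem weighted_variance_eq_zero_iff (S : Finset ι) (hS : S.Nonempty) (c K : ι → ℝ)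
    (hc : ∀ g, 0 < c g) :
    (∑ g ∈ S, c g * K g ^ 2) / (∑ g ∈ S, c g) - ((∑ g ∈ S, c g * K g) / (∑ g ∈ S, c g)) ^ 2 = 0 ↔
      ∀ g ∈ S, ∀ h ∈ S, K g = K h := by
  have hC : 0 < ∑ g ∈ S, c g := Finset.sum_pos (fun g _ => hc g) hS
  set C := ∑ g ∈ S, c g with hCdef
  set μ := (∑ g ∈ S, c g * K g) / C with hμ
  have hm : ∑ g ∈ S, c g * K g = μ * C := by rw [hμ]; field_simp
  have key : (∑ g ∈ S, c g * K g ^ 2) / C - μ ^ 2 = (∑ g ∈ S, c g * (K g - μ) ^ 2) / C := by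
    have : ∑ g ∈ S, c g * (K g - μ) ^ 2 =
        ∑ g ∈ S, c g * K g ^ 2 - 2 * μ * ∑ g ∈ S, c g * K g + μ ^ 2 * C := by
      rw [hCdef, Finset.mul_sum, Finset.mul_sum, ← Finset.sum_sub_distrib, ← Finset.sum_add_distrib]
      exact Finset.sum_congr rfl fun g _ => by ring
    rw [this, hm]
    field_simp
    ring
  rw [key, div_eq_zero_iff, or_iff_left hC.ne',
    Finset.sum_eq_zero_iff_of_nonneg fun g _ => mul_nonneg (hc g).le (sq_nonneg _)]
  constructor
  · intro h g hg g' hg'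
    have aux : ∀ g ∈ S, K g = μ := fun g hg => by
      have := h g hg
      rw [mul_eq_zero, or_iff_right (hc g).ne'] at this
      exact sub_eq_zero.1 (pow_eq_zero_iff two_ne_zero |>.1 this)
    rw [aux g hg, aux g' hg']
  · intro h g hg
    have : μ = K g := by
      rw [hμ, div_eq_iff hC.ne', hCdef, Finset.mul_sum]
      exact Finset.sum_congr rfl fun g' hg' => by rw [h g' hg' g hg]; ring
    rw [this]; ring

end Exponentials

/-! ### Expansion of the tau-function and the large-scale limit of the solution -/

section Tau

variable {N : ℕ}

theorem phase_smul (k θ₀ : Fin N → ℝ) (s t : ℝ) (p : ℝ × ℝ) (i : Fin N) :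
    phase k (s • θ₀) (s * t) (s • p) i = s * phase k θ₀ t p i := by
  simp only [phase, Pi.smul_apply, Prod.smul_fst, Prod.smul_snd, smul_eq_mul]
  ring

theorem iteratedDeriv_expSum (k θ₀ : Fin N → ℝ) (t y : ℝ) (n : ℕ) :
    iteratedDeriv n (fun x => expSum k θ₀ t (x, y)) =
      fun x => ∑ i, (-k i) ^ n * Real.exp (phase k θ₀ t (x, y) i) := by
  induction n with
  | zero => simp [expSum]
  | succ n ih =>
    rw [iteratedDeriv_succ, ih]
    funext x
    refine HasDerivAt.deriv (HasDerivAt.fun_sum fun i _ => ?_)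
    have h : HasDerivAt (fun x => phase k θ₀ t (x, y) i) (-k i) x := by
      have h := ((((hasDerivAt_id x).const_mul (-k i)).add_const (k i ^ 2 * y)).sub_const
        (k i ^ 3 * t)).add_const (θ₀ i)
      simpa [phase] using h
    refine (h.exp.const_mul _).congr_deriv ?_
    ring

/-- Symmetrized Cauchy–Binet formula for a Hankel matrix of moments. -/
theorem det_moments {R : Type*} [Field R] [CharZero R] (M : ℕ) (w z : Fin N → R) :
    Matrix.det (Matrix.of fun a b : Fin M => ∑ i, w i * z i ^ ((a : ℕ) + (b : ℕ))) =
      ((M.factorial : R))⁻¹ * ∑ g : Fin M → Fin N,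
        (∏ a, w (g a)) * (Matrix.vandermonde (z ∘ g)).det ^ 2 := by
  classical
  -- Multilinearity in the rows: each row is a sum over `i`, and `g` records the choice made in
  -- every row.
  have h1 : Matrix.det (Matrix.of fun a b : Fin M => ∑ i, w i * z i ^ ((a : ℕ) + (b : ℕ))) =
      ∑ g : Fin M → Fin N, (∏ a, w (g a)) * ((∏ a, z (g a) ^ (a : ℕ)) *
        (Matrix.vandermonde (z ∘ g)).det) := by
    have : (Matrix.of fun a b : Fin M => ∑ i, w i * z i ^ ((a : ℕ) + (b : ℕ))) =
        fun a : Fin M => ∑ i : Fin N, (w i * z i ^ (a : ℕ)) • fun b : Fin M => z i ^ (b : ℕ) := by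
      funext a b
      simp only [Matrix.of_apply, Finset.sum_apply, Pi.smul_apply, smul_eq_mul]
      exact Finset.sum_congr rfl fun i _ => by ring
    rw [this]
    change Matrix.detRowAlternating.toMultilinearMap _ = _
    rw [MultilinearMap.map_sum]
    refine Finset.sum_congr rfl fun g _ => ?_
    rw [MultilinearMap.map_smul_univ, Finset.prod_mul_distrib, smul_eq_mul, mul_assoc]
    rfl
  -- Reindexing `g` by `σ` permutes the rows of the Vandermonde matrix. Summing over all `M!`
  -- permutations turns the remaining product into a second Vandermonde determinant.
  have h2 : ∀ σ : Equiv.Perm (Fin M), ∑ g : Fin M → Fin N, (∏ a, w (g a)) *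
      ((∏ a, z (g a) ^ (a : ℕ)) * (Matrix.vandermonde (z ∘ g)).det) =
      ∑ g : Fin M → Fin N, (∏ a, w (g a)) * (((Equiv.Perm.sign σ : ℤ) *
        ∏ a, z (g (σ a)) ^ (a : ℕ)) * (Matrix.vandermonde (z ∘ g)).det) := by
    intro σ
    rw [← Equiv.sum_comp (Equiv.arrowCongr σ.symm (Equiv.refl (Fin N)))]
    refine Finset.sum_congr rfl fun g _ => ?_
    have e1 : ∏ a, w (g (σ a)) = ∏ a, w (g a) := Equiv.prod_comp σ fun a => w (g a)
    have e2 : (Matrix.vandermonde (z ∘ g ∘ σ)).det =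
        (Equiv.Perm.sign σ : ℤ) * (Matrix.vandermonde (z ∘ g)).det := by
      rw [← Matrix.det_permute]; rfl
    have e3 : Equiv.arrowCongr σ.symm (Equiv.refl (Fin N)) g = g ∘ σ := rfl
    rw [e3]
    simp only [Function.comp_apply]
    rw [e1, e2]
    ring
  have hf : (M.factorial : R) ≠ 0 := Nat.cast_ne_zero.2 M.factorial_ne_zero
  rw [h1, eq_inv_mul_iff_mul_eq₀ hf]
  have h3 := Finset.sum_congr (rfl : (Finset.univ : Finset (Equiv.Perm (Fin M))) = _)
    fun σ _ => h2 σ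
  rw [Finset.sum_const, Finset.card_univ, Fintype.card_perm, Fintype.card_fin, nsmul_eq_mul] at h3
  rw [h3, Finset.sum_comm]
  refine Finset.sum_congr rfl fun g _ => ?_
  rw [← Finset.mul_sum, ← Finset.sum_mul, sq]
  congr 2
  rw [Matrix.det_apply']
  rfl

theorem vandermonde_coeff_pos (M : ℕ) (k : Fin N → ℝ) (hk : Function.Injective k)
    (g : Fin M ↪ Fin N) :
    0 < (M.factorial : ℝ)⁻¹ * (Matrix.vandermonde fun a => -k (g a)).det ^ 2 := by
  have : (Matrix.vandermonde fun a => -k (g a)).det ≠ 0 :=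
    Matrix.det_vandermonde_ne_zero_iff.2 fun a b h => g.injective (hk (neg_injective h))
  have := M.factorial_pos
  positivity

/-- The expansion of the tau-function into exponentials, with positive coefficients. -/
theorem tau_eq (M : ℕ) (k θ₀ : Fin N → ℝ) (t : ℝ) (p : ℝ × ℝ) :
    tau M k θ₀ t p = ∑ g : Fin M ↪ Fin N,
      ((M.factorial : ℝ)⁻¹ * (Matrix.vandermonde fun a => -k (g a)).det ^ 2) *
        Real.exp (∑ a, phase k θ₀ t p (g a)) := by
  classical
  unfold tau
  simp only [iteratedDeriv_expSum]
  have h := det_moments M (fun i => Real.exp (phase k θ₀ t p i)) (fun i => -k i)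
  have e : (Matrix.of fun a b : Fin M => ∑ i, (-k i) ^ ((a : ℕ) + (b : ℕ)) *
      Real.exp (phase k θ₀ t (p.1, p.2) i)) = Matrix.of fun a b : Fin M => ∑ i,
        Real.exp (phase k θ₀ t p i) * (-k i) ^ ((a : ℕ) + (b : ℕ)) := by
    ext a b
    simp [mul_comm]
  rw [e, h, Finset.mul_sum, eq_comm]
  -- A non-injective `g` repeats a node, so its Vandermonde determinant vanishes and only embeddings
  -- remain.
  refine Fintype.sum_of_injective (fun g : Fin M ↪ Fin N => (g : Fin M → Fin N))
    DFunLike.coe_injective _ _ (fun g hg => ?_) fun g => ?_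
  · have : ¬ Function.Injective ((fun i => -k i) ∘ g) := fun hinj =>
      hg ⟨⟨g, hinj.of_comp⟩, rfl⟩
    have h0 : (Matrix.vandermonde ((fun i => -k i) ∘ g)).det = 0 := by
      by_contra h0
      exact this (Matrix.det_vandermonde_ne_zero_iff.1 h0)
    rw [h0]; ring
  · rw [Real.exp_sum]
    simp only [Function.comp_def]
    ring

/-- The factor `exp (-v)` cancels in every quotient. Taking the largest exponent for `v` keeps
numerators and denominators convergent under scaling. -/
theorem solution_eq (M : ℕ) (hM : M ≤ N) (k θ₀ : Fin N → ℝ) (hk : Function.Injective k) (t : ℝ)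
    (p : ℝ × ℝ) (v : ℝ) :
    let c : (Fin M ↪ Fin N) → ℝ := fun g =>
      (M.factorial : ℝ)⁻¹ * (Matrix.vandermonde fun a => -k (g a)).det ^ 2
    let w : (Fin M ↪ Fin N) → ℝ := fun g => Real.exp (∑ a, phase k θ₀ t p (g a) - v)
    solution M k θ₀ t p = 2 * ((∑ g, c g * (∑ a, k (g a)) ^ 2 * w g) / (∑ g, c g * w g) -
      ((∑ g, c g * (∑ a, k (g a)) * w g) / (∑ g, c g * w g)) ^ 2) := by
  intro c w
  have hne : Nonempty (Fin M ↪ Fin N) := ⟨Fin.castLEEmb hM⟩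
  have hc := vandermonde_coeff_pos M k hk
  unfold solution
  let b : (Fin M ↪ Fin N) → ℝ := fun g => ∑ a, phase k θ₀ t (0, p.2) (g a)
  have hphase : ∀ x g, ∑ a, phase k θ₀ t (x, p.2) (g a) = b g - (∑ a, k (g a)) * x := by
    intro x g
    simp only [b, Finset.sum_mul, ← Finset.sum_sub_distrib, phase]
    exact Finset.sum_congr rfl fun a _ => by ring
  simp only [tau_eq, hphase]
  rw [iteratedDeriv_two_log_sum_exp _ _ _ hc]
  have hw : ∀ d : (Fin M ↪ Fin N) → ℝ, ∑ g, d g * w g =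
      (∑ g, d g * Real.exp (b g - (∑ a, k (g a)) * p.1)) * Real.exp (-v) := by
    intro d
    rw [Finset.sum_mul]
    refine Finset.sum_congr rfl fun g _ => ?_
    rw [← hphase, mul_assoc, ← Real.exp_add, ← sub_eq_add_neg]
  rw [hw, hw, hw, mul_div_mul_right _ _ (Real.exp_pos _).ne',
    mul_div_mul_right _ _ (Real.exp_pos _).ne']

/-- On large scales the solution converges to twice the variance of the wave numbers over the
dominant exponentials. -/
theorem tendsto_solution_smul (M : ℕ) (hM : M ≤ N) (k θ₀ : Fin N → ℝ) (hk : Function.Injective k)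
    (t : ℝ) (p : ℝ × ℝ) (v : ℝ) (S : Finset (Fin M ↪ Fin N))
    (hS : S.Nonempty) (hSv : ∀ g, g ∈ S ↔ ∑ a, phase k θ₀ t p (g a) = v)
    (hv : ∀ g : Fin M ↪ Fin N, ∑ a, phase k θ₀ t p (g a) ≤ v) :
    Filter.Tendsto (fun s : ℝ => solution M k (s • θ₀) (s * t) (s • p)) Filter.atTop (𝓝 0) ↔
      ∀ g ∈ S, ∀ h ∈ S, ∑ a, k (g a) = ∑ a, k (h a) := by
  classical
  have hc := vandermonde_coeff_pos M k hk
  set c : (Fin M ↪ Fin N) → ℝ := fun g =>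
      (M.factorial : ℝ)⁻¹ * (Matrix.vandermonde fun a => -k (g a)).det ^ 2 with hcdef
  have hS' : (Finset.univ.filter fun g : Fin M ↪ Fin N => ∑ a, phase k θ₀ t p (g a) = v) = S := by
    ext g; simp [hSv]
  have hlim : ∀ d : (Fin M ↪ Fin N) → ℝ, Filter.Tendsto (fun s : ℝ => ∑ g, d g *
      Real.exp (∑ a, phase k (s • θ₀) (s * t) (s • p) (g a) - s * v)) Filter.atTop
      (𝓝 (∑ g ∈ S, d g)) := by
    intro d
    have h := tendsto_sum_mul_exp d (fun g : Fin M ↪ Fin N => ∑ a, phase k θ₀ t p (g a)) v hv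
    rw [hS'] at h
    refine h.congr fun s => Finset.sum_congr rfl fun g _ => ?_
    simp only [phase_smul, ← Finset.mul_sum, mul_sub]
  have hC : (∑ g ∈ S, c g) ≠ 0 := (Finset.sum_pos (fun g _ => hc g) hS).ne'
  have hmain : Filter.Tendsto (fun s : ℝ => solution M k (s • θ₀) (s * t) (s • p)) Filter.atTop
      (𝓝 (2 * ((∑ g ∈ S, c g * (∑ a, k (g a)) ^ 2) / (∑ g ∈ S, c g) -
        ((∑ g ∈ S, c g * (∑ a, k (g a))) / (∑ g ∈ S, c g)) ^ 2))) := by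
    refine Filter.Tendsto.congr (fun s => (solution_eq M hM k _ hk _ _ (s * v)).symm) ?_
    exact (((hlim _).div (hlim c) hC).sub (((hlim _).div (hlim c) hC).pow 2)).const_mul 2
  rw [← weighted_variance_eq_zero_iff S hS c _ hc]
  constructor
  · intro h
    have := tendsto_nhds_unique h hmain
    linarith
  · intro h
    rwa [h, mul_zero] at hmain

end Tau

/-! ### Maximal sums over subsets of given size -/

section Selection

variable {ι : Type*} [DecidableEq ι]

/-- If every value on `I` dominates every value off `I`, then `I` maximizes the sum among all sets
of the same size. -/
theorem sum_le_sum_of_forall_le (f : ι → ℝ) {I J : Finset ι} (hcard : J.card = I.card)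
    (h : ∀ i ∈ I, ∀ j ∉ I, f j ≤ f i) : ∑ j ∈ J, f j ≤ ∑ i ∈ I, f i := by
  rw [← Finset.sum_inter_add_sum_sdiff J I, ← Finset.sum_inter_add_sum_sdiff I J,
    Finset.inter_comm I J]
  refine add_le_add le_rfl ?_
  have hc : (J \ I).card = (I \ J).card := Finset.card_sdiff_comm hcard
  rcases (J \ I).eq_empty_or_nonempty with he | hne
  · have he' : I \ J = ∅ := by rwa [← Finset.card_eq_zero, ← hc, Finset.card_eq_zero]
    rw [he, he']
  · obtain ⟨j, hj, hmax⟩ := Finset.exists_max_image (J \ I) f hne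
    calc ∑ j ∈ J \ I, f j ≤ (J \ I).card • f j := Finset.sum_le_card_nsmul _ _ _ hmax
      _ = (I \ J).card • f j := by rw [hc]
      _ ≤ ∑ i ∈ I \ J, f i := Finset.card_nsmul_le_sum _ _ _ fun i hi =>
          h i (Finset.mem_sdiff.1 hi).1 j (Finset.mem_sdiff.1 hj).2

theorem sum_insert_erase (f : ι → ℝ) {I : Finset ι} {i j : ι} (hi : i ∈ I) (hj : j ∉ I) :
    ∑ m ∈ insert j (I.erase i), f m = ∑ m ∈ I, f m - f i + f j := by
  rw [Finset.sum_insert fun h => hj (Finset.mem_of_mem_erase h), ← Finset.add_sum_erase I f hi]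
  ring

theorem card_insert_erase {I : Finset ι} {i j : ι} (hi : i ∈ I) (hj : j ∉ I) :
    (insert j (I.erase i)).card = I.card := by
  rw [Finset.card_insert_of_notMem fun h => hj (Finset.mem_of_mem_erase h),
    Finset.card_erase_add_one hi]

/-- Some set of each size collects the largest values. -/
theorem exists_threshold [Fintype ι] (f : ι → ℝ) {M : ℕ} (hM : 0 < M) (hMN : M ≤ Fintype.card ι) :
    ∃ v, (Finset.univ.filter fun i => v < f i).card < M ∧
      M ≤ (Finset.univ.filter fun i => v ≤ f i).card := by
  obtain ⟨s, hs, hmax⟩ := Finset.exists_max_image (Finset.powersetCard M (Finset.univ : Finset ι))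
    (fun I => ∑ i ∈ I, f i) (Finset.powersetCard_nonempty.2 (by simpa using hMN))
  rw [Finset.mem_powersetCard_univ] at hs
  obtain ⟨i, hi, hmin⟩ := Finset.exists_min_image s f (Finset.card_pos.1 (hs ▸ hM))
  have hout : ∀ j ∉ s, f j ≤ f i := by
    intro j hj
    have := hmax (insert j (s.erase i)) (by
      rw [Finset.mem_powersetCard_univ, card_insert_erase hi hj, hs])
    simp only [sum_insert_erase f hi hj] at this
    linarith
  refine ⟨f i, ?_, ?_⟩
  · calc (Finset.univ.filter fun j => f i < f j).card ≤ (s.erase i).card := by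
          refine Finset.card_le_card fun j hj => ?_
          have hj' : f i < f j := by simpa using hj
          refine Finset.mem_erase.2 ⟨fun h => hj'.ne' (by rw [h]), ?_⟩
          by_contra hjs
          exact absurd (hout j hjs) (not_le.2 hj')
      _ < s.card := Finset.card_erase_lt_of_mem hi
      _ = M := hs
  · rw [← hs]
    exact Finset.card_le_card fun j hj => by simpa using hmin j hj

end Selection

/-- By this bound, at most three dominant sets at a graph point leave at most three phases tied at
the threshold. -/
theorem le_choose_of_pos_of_lt {b m : ℕ} (h0 : 0 < m) (h1 : m < b) : b ≤ b.choose m := by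
  induction b generalizing m with
  | zero => omega
  | succ b ih =>
    obtain ⟨m, rfl⟩ : ∃ n, m = n + 1 := ⟨m - 1, by omega⟩
    rw [Nat.choose_succ_succ']
    rcases Nat.eq_or_lt_of_le (Nat.lt_succ_iff.1 h1) with h | h
    · subst h; simp
    · have := ih (by omega) h
      have := Nat.choose_pos (n := b) (k := m) (by omega)
      omega

/-! ### Dominant index sets, ties at the threshold, and visibility of the graph -/

section Dominant

variable {N M : ℕ} {k θ₀ : Fin N → ℝ} {t : ℝ} {p : ℝ × ℝ}

/-- The closed convex region of the points at which `I` collects the largest phases. -/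
def closedRegion (k θ₀ : Fin N → ℝ) (t : ℝ) (I : Finset (Fin N)) : Set (ℝ × ℝ) :=
  {p | ∀ i ∈ I, ∀ j ∉ I, phase k θ₀ t p j ≤ phase k θ₀ t p i}

/-- The open convex region of the points at which `I` strictly collects the largest phases. -/
def region (k θ₀ : Fin N → ℝ) (t : ℝ) (I : Finset (Fin N)) : Set (ℝ × ℝ) :=
  {p | ∀ i ∈ I, ∀ j ∉ I, phase k θ₀ t p j < phase k θ₀ t p i}

theorem region_subset_closedRegion (I : Finset (Fin N)) :
    region k θ₀ t I ⊆ closedRegion k θ₀ t I := fun _ hp i hi j hj => (hp i hi j hj).le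

/-- Exchanging one member for a non-member changes the sum by the difference of their phases, so
maximality reduces to pairwise linear inequalities. -/
theorem mem_dominant_iff {I : Finset (Fin N)} :
    I ∈ dominant M k θ₀ t p ↔ I.card = M ∧ p ∈ closedRegion k θ₀ t I := by
  refine and_congr_right fun hI => ⟨fun h i hi j hj => ?_, fun h J hJ => ?_⟩
  · have := h (insert j (I.erase i)) ((card_insert_erase hi hj).trans hI)
    rw [sum_insert_erase _ hi hj] at this
    linarith
  · exact sum_le_sum_of_forall_le _ (hJ.trans hI.symm) h

theorem dominant_nonempty (hM : M ≤ N) : (dominant M k θ₀ t p).Nonempty := by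
  obtain ⟨s, hs, hmax⟩ := Finset.exists_max_image
    (Finset.powersetCard M (Finset.univ : Finset (Fin N)))
    (fun I => ∑ i ∈ I, phase k θ₀ t p i) (Finset.powersetCard_nonempty.2 (by simpa using hM))
  exact ⟨s, Finset.mem_powersetCard_univ.1 hs,
    fun J hJ => hmax J (Finset.mem_powersetCard_univ.2 hJ)⟩

/-- The indices whose phase exceeds `v`. -/
def above (k θ₀ : Fin N → ℝ) (t : ℝ) (p : ℝ × ℝ) (v : ℝ) : Finset (Fin N) :=
  Finset.univ.filter fun i => v < phase k θ₀ t p i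

/-- The indices whose phase equals `v`. -/
def level (k θ₀ : Fin N → ℝ) (t : ℝ) (p : ℝ × ℝ) (v : ℝ) : Finset (Fin N) :=
  Finset.univ.filter fun i => phase k θ₀ t p i = v

@[simp] theorem mem_above {v : ℝ} {i : Fin N} : i ∈ above k θ₀ t p v ↔ v < phase k θ₀ t p i := by
  simp [above]

@[simp] theorem mem_level {v : ℝ} {i : Fin N} : i ∈ level k θ₀ t p v ↔ phase k θ₀ t p i = v := by
  simp [level]

theorem disjoint_above_level (v : ℝ) : Disjoint (above k θ₀ t p v) (level k θ₀ t p v) :=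
  Finset.disjoint_left.2 fun i h h' => by
    rw [mem_above] at h; rw [mem_level] at h'; exact h.ne' h'

theorem exists_level (hM : 0 < M) (hMN : M ≤ N) (k θ₀ : Fin N → ℝ) (t : ℝ) (p : ℝ × ℝ) :
    ∃ v, (above k θ₀ t p v).card < M ∧
      M ≤ (above k θ₀ t p v).card + (level k θ₀ t p v).card := by
  obtain ⟨v, h1, h2⟩ := exists_threshold (phase k θ₀ t p) hM (by simpa using hMN)
  refine ⟨v, h1, h2.trans ?_⟩
  rw [← Finset.card_union_of_disjoint (disjoint_above_level v)]
  refine Finset.card_le_card fun i hi => ?_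
  have : v ≤ phase k θ₀ t p i := by simpa using hi
  rcases this.lt_or_eq with h | h
  · exact Finset.mem_union_left _ (mem_above.2 h)
  · exact Finset.mem_union_right _ (mem_level.2 h.symm)

/-- The dominant index sets: everything above the threshold, and any selection of the right size
at the threshold. -/
theorem mem_dominant_iff_of_level {v : ℝ} (h1 : (above k θ₀ t p v).card < M)
    (h2 : M ≤ (above k θ₀ t p v).card + (level k θ₀ t p v).card) {I : Finset (Fin N)} :
    I ∈ dominant M k θ₀ t p ↔ I.card = M ∧ above k θ₀ t p v ⊆ I ∧
      I ⊆ above k θ₀ t p v ∪ level k θ₀ t p v := by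
  rw [mem_dominant_iff]
  refine and_congr_right fun hI => ⟨fun h => ⟨fun i hi => ?_, fun i hi => ?_⟩, ?_⟩
  · by_contra hiI
    have : I ⊆ (above k θ₀ t p v).erase i := fun j hj => by
      refine Finset.mem_erase.2 ⟨fun e => hiI (e ▸ hj), mem_above.2 ?_⟩
      exact (mem_above.1 hi).trans_le (h j hj i hiI)
    have := (Finset.card_le_card this).trans (Finset.card_erase_le)
    omega
  · by_contra hiU
    rw [Finset.mem_union, mem_above, mem_level, not_or, not_lt] at hiU
    have hlt := lt_of_le_of_ne hiU.1 hiU.2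
    have : above k θ₀ t p v ∪ level k θ₀ t p v ⊆ I.erase i := fun j hj => by
      have hj' : v ≤ phase k θ₀ t p j := by
        rw [Finset.mem_union, mem_above, mem_level] at hj
        rcases hj with hj | hj
        · exact hj.le
        · exact hj.ge
      refine Finset.mem_erase.2 ⟨fun e => absurd (e ▸ hj') (not_le.2 hlt), ?_⟩
      by_contra hjI
      exact absurd (h i hi j hjI) (not_le.2 (hlt.trans_le hj'))
    have := Finset.card_le_card this
    rw [Finset.card_union_of_disjoint (disjoint_above_level v)] at this
    have := Finset.card_erase_lt_of_mem hi
    omega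
  · rintro ⟨hA, hB⟩ i hi j hj
    have hi' : v ≤ phase k θ₀ t p i := by
      have := hB hi
      rw [Finset.mem_union, mem_above, mem_level] at this
      rcases this with h | h
      · exact h.le
      · exact h.ge
    refine le_trans ?_ hi'
    by_contra hlt
    exact hj (hA (mem_above.2 (not_le.1 hlt)))

/-- The indices in `above` are forced and the rest is a free choice within `level`. Genericity thus
becomes a bound on a binomial coefficient. -/
theorem encard_dominant {v : ℝ} (h1 : (above k θ₀ t p v).card < M)
    (h2 : M ≤ (above k θ₀ t p v).card + (level k θ₀ t p v).card) :
    (dominant M k θ₀ t p).encard =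
      ((level k θ₀ t p v).card.choose (M - (above k θ₀ t p v).card) : ℕ) := by
  have hd := disjoint_above_level (k := k) (θ₀ := θ₀) (t := t) (p := p) v
  have : dominant M k θ₀ t p = (fun S => above k θ₀ t p v ∪ S) ''
      (Finset.powersetCard (M - (above k θ₀ t p v).card) (level k θ₀ t p v) :
        Set (Finset (Fin N))) := by
    ext I
    rw [mem_dominant_iff_of_level h1 h2]
    simp only [Set.mem_image, Finset.mem_coe, Finset.mem_powersetCard]
    constructor
    · rintro ⟨hI, hA, hB⟩
      refine ⟨I \ above k θ₀ t p v, ⟨?_, ?_⟩, Finset.union_sdiff_of_subset hA⟩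
      · exact sdiff_le_iff.2 hB
      · rw [Finset.card_sdiff_of_subset hA, hI]
    · rintro ⟨S, ⟨hS, hc⟩, rfl⟩
      refine ⟨?_, Finset.subset_union_left, Finset.union_subset_union_right hS⟩
      rw [Finset.card_union_of_disjoint (hd.mono_right hS), hc]
      omega
  rw [this, Set.InjOn.encard_image, Set.encard_coe_eq_coe_finsetCard, Finset.card_powersetCard]
  intro S hS S' hS' h
  rw [Finset.mem_coe] at hS hS'
  have e : ∀ S, S ⊆ level k θ₀ t p v → (above k θ₀ t p v ∪ S) \ above k θ₀ t p v = S :=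
    fun S hS => Finset.union_sdiff_cancel_left (hd.mono_right hS)
  rw [← e S (Finset.mem_powersetCard.1 hS).1, ← e S' (Finset.mem_powersetCard.1 hS').1]
  simp only at h
  rw [h]

/-- In the generic situation at most three phases meet at the threshold of a graph point. -/
theorem IsGeneric.card_level_le (h : IsGeneric M k θ₀ t) (p : ℝ × ℝ) {v : ℝ}
    (h1 : (above k θ₀ t p v).card < M)
    (h2 : M < (above k θ₀ t p v).card + (level k θ₀ t p v).card) :
    (level k θ₀ t p v).card ≤ 3 := by
  have h3 := h p
  rw [encard_dominant h1 h2.le] at h3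
  have h4 : (level k θ₀ t p v).card.choose (M - (above k θ₀ t p v).card) ≤ 3 := by
    exact_mod_cast h3
  exact (le_choose_of_pos_of_lt (by omega) (by omega)).trans h4

theorem exists_embedding_map_eq {I : Finset (Fin N)} (hI : I.card = M) :
    ∃ g : Fin M ↪ Fin N, Finset.univ.map g = I :=
  ⟨(I.orderEmbOfFin hI).toEmbedding, by simp⟩

/-- A point lies on the graph if and only if the solution stays visible there on large scales. -/
theorem mem_graph_iff_not_tendsto (hM : M ≤ N) (hk : Function.Injective k) :
    p ∈ graph M k θ₀ t ↔ ¬ Filter.Tendsto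
      (fun s : ℝ => solution M k (s • θ₀) (s * t) (s • p)) Filter.atTop (𝓝 0) := by
  classical
  obtain ⟨I₀, hI₀⟩ := dominant_nonempty (k := k) (θ₀ := θ₀) (t := t) (p := p) hM
  have hsum : ∀ (f : Fin N → ℝ) (g : Fin M ↪ Fin N),
      ∑ a, f (g a) = ∑ i ∈ Finset.univ.map g, f i := fun f g => (Finset.sum_map _ _ _).symm
  have hcard : ∀ g : Fin M ↪ Fin N, (Finset.univ.map g).card = M := by simp
  set v := ∑ i ∈ I₀, phase k θ₀ t p i with hv
  have hle : ∀ J : Finset (Fin N), J.card = M → ∑ j ∈ J, phase k θ₀ t p j ≤ v := hI₀.2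
  have hdom : ∀ J : Finset (Fin N), J ∈ dominant M k θ₀ t p ↔
      J.card = M ∧ ∑ j ∈ J, phase k θ₀ t p j = v := by
    intro J
    constructor
    · intro hJ
      exact ⟨hJ.1, le_antisymm (hle J hJ.1) (hJ.2 I₀ hI₀.1)⟩
    · rintro ⟨hJ, he⟩
      exact ⟨hJ, fun J' hJ' => he ▸ hle J' hJ'⟩
  let S : Finset (Fin M ↪ Fin N) := Finset.univ.filter fun g => ∑ a, phase k θ₀ t p (g a) = v
  have hSv : ∀ g, g ∈ S ↔ ∑ a, phase k θ₀ t p (g a) = v := by simp [S]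
  have hSd : ∀ g, g ∈ S ↔ Finset.univ.map g ∈ dominant M k θ₀ t p := fun g => by
    rw [hSv, hdom, ← hsum]; simp [hcard]
  have hSne : S.Nonempty := by
    obtain ⟨g, hg⟩ := exists_embedding_map_eq hI₀.1
    exact ⟨g, (hSd g).2 (hg ▸ hI₀)⟩
  rw [tendsto_solution_smul M hM k θ₀ hk t p v S hSne hSv
    (fun g => by rw [hsum]; exact hle _ (hcard g)), ← not_iff_not, not_not]
  change ¬ (dominant M k θ₀ t p).Nontrivial ↔ _
  rw [Set.not_nontrivial_iff]
  symm
  constructor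
  · intro h
    by_contra hnt
    rw [Set.not_subsingleton_iff] at hnt
    obtain ⟨I, hI, J, hJ, hne⟩ := hnt
    obtain ⟨i, hiI, hiJ⟩ : ∃ i ∈ I, i ∉ J := by
      by_contra hcon
      push Not at hcon
      exact hne (Finset.eq_of_subset_of_card_le hcon (by rw [hI.1, hJ.1]))
    obtain ⟨j, hjJ, hjI⟩ : ∃ j ∈ J, j ∉ I := by
      by_contra hcon
      push Not at hcon
      exact hne (Finset.eq_of_subset_of_card_le hcon (by rw [hI.1, hJ.1])).symm
    have e : phase k θ₀ t p i = phase k θ₀ t p j :=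
      le_antisymm ((mem_dominant_iff.1 hJ).2 j hjJ i hiJ) ((mem_dominant_iff.1 hI).2 i hiI j hjI)
    -- `I` and `J` themselves may have equal wave numbers; the exchange of a single tied pair yields
    -- a dominant set whose wave number differs by `k j - k i`.
    have hI' : insert j (I.erase i) ∈ dominant M k θ₀ t p := by
      rw [hdom, card_insert_erase hiI hjI, sum_insert_erase _ hiI hjI, e]
      have := (hdom I).1 hI
      refine ⟨this.1, by rw [this.2]; ring⟩
    obtain ⟨g, hg⟩ := exists_embedding_map_eq hI.1
    obtain ⟨g', hg'⟩ := exists_embedding_map_eq hI'.1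
    have := h g ((hSd g).2 (hg ▸ hI)) g' ((hSd g').2 (hg' ▸ hI'))
    rw [hsum, hsum, hg, hg', sum_insert_erase _ hiI hjI] at this
    have : k i = k j := by linarith
    exact hjI (hk this ▸ hiI)
  · intro h g hg g' hg'
    rw [hsum, hsum, h ((hSd g).1 hg) ((hSd g').1 hg')]

end Dominant

/-! ### Exceptional times and phase constants -/

section Generic

variable {N M : ℕ}

/-- With at most three phases tied at the threshold, the number of dominant sets would be at most
`Nat.choose 3 m ≤ 3`. -/
theorem exists_four_of_not_isGeneric (hM : 0 < M) (hMN : M ≤ N) {k θ₀ : Fin N → ℝ} {t : ℝ}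
    (h : ¬ IsGeneric M k θ₀ t) : ∃ (g : Fin 4 ↪ Fin N) (p : ℝ × ℝ) (v : ℝ),
      ∀ a, phase k θ₀ t p (g a) = v := by
  rw [IsGeneric] at h
  push Not at h
  obtain ⟨p, hp⟩ := h
  obtain ⟨v, h1, h2⟩ := exists_level hM hMN k θ₀ t p
  rw [encard_dominant h1 h2] at hp
  have hp' : 3 < (level k θ₀ t p v).card.choose (M - (above k θ₀ t p v).card) := by
    exact_mod_cast hp
  have hb : 4 ≤ (level k θ₀ t p v).card := by
    by_contra hb
    have : (level k θ₀ t p v).card ≤ 3 := by omega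
    have h3 : Nat.choose 3 (M - (above k θ₀ t p v).card) ≤ 3 := by
      have := Nat.choose_le_middle (M - (above k θ₀ t p v).card) 3
      simpa using this
    have := Nat.choose_le_choose (M - (above k θ₀ t p v).card) this
    omega
  obtain ⟨S, hS, hc⟩ := Finset.exists_subset_card_eq hb
  refine ⟨(S.orderEmbOfFin hc).toEmbedding, p, v, fun a => mem_level.1 (hS ?_)⟩
  exact Finset.orderEmbOfFin_mem S hc a

/-- The third divided difference of `θ₀` at four wave numbers. -/
def dividedDiff (k : Fin N → ℝ) (g : Fin 4 ↪ Fin N) : (Fin N → ℝ) →ₗ[ℝ] ℝ :=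
  ∑ a, (∏ b ∈ Finset.univ.erase a, (k (g a) - k (g b)))⁻¹ • LinearMap.proj (g a)

/-- Third divided differences annihilate polynomials of degree at most two in `k`, which removes
`v`, `p.1` and `p.2`, and they take the value one on the cube. -/
theorem dividedDiff_eq_time {k θ₀ : Fin N → ℝ} (hk : Function.Injective k) {t : ℝ}
    (g : Fin 4 ↪ Fin N) {p : ℝ × ℝ} {v : ℝ} (h : ∀ a, phase k θ₀ t p (g a) = v) :
    dividedDiff k g θ₀ = t := by
  have hne : ∀ a b : Fin 4, a ≠ b → k (g a) - k (g b) ≠ 0 := fun a b hab =>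
    sub_ne_zero.2 fun e => hab (g.injective (hk e))
  have h01 := hne 0 1 (by decide)
  have h02 := hne 0 2 (by decide)
  have h03 := hne 0 3 (by decide)
  have h12 := hne 1 2 (by decide)
  have h13 := hne 1 3 (by decide)
  have h23 := hne 2 3 (by decide)
  have e0 : (Finset.univ.erase (0 : Fin 4)) = {1, 2, 3} := by decide
  have e1 : (Finset.univ.erase (1 : Fin 4)) = {0, 2, 3} := by decide
  have e2 : (Finset.univ.erase (2 : Fin 4)) = {0, 1, 3} := by decide
  have e3 : (Finset.univ.erase (3 : Fin 4)) = {0, 1, 2} := by decide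
  have hθ : ∀ a, θ₀ (g a) = v + k (g a) * p.1 - k (g a) ^ 2 * p.2 + k (g a) ^ 3 * t := fun a => by
    have := h a
    unfold phase at this
    linarith
  simp only [dividedDiff, Fin.sum_univ_four, e0, e1, e2, e3, LinearMap.add_apply,
    LinearMap.smul_apply, LinearMap.proj_apply, smul_eq_mul, hθ]
  rw [Finset.prod_insert (by decide), Finset.prod_insert (by decide), Finset.prod_singleton,
    Finset.prod_insert (by decide), Finset.prod_insert (by decide), Finset.prod_singleton,
    Finset.prod_insert (by decide), Finset.prod_insert (by decide), Finset.prod_singleton,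
    Finset.prod_insert (by decide), Finset.prod_insert (by decide), Finset.prod_singleton]
  rw [← neg_sub (k (g 0)) (k (g 1)), ← neg_sub (k (g 0)) (k (g 2)), ← neg_sub (k (g 0)) (k (g 3)),
    ← neg_sub (k (g 1)) (k (g 2)), ← neg_sub (k (g 1)) (k (g 3)), ← neg_sub (k (g 2)) (k (g 3))]
  field_simp
  ring

theorem dividedDiff_ne_zero {k : Fin N → ℝ} (hk : Function.Injective k) (g : Fin 4 ↪ Fin N) :
    dividedDiff k g ≠ 0 := by
  intro h
  -- For these constants all phases vanish at the origin at time `1`, so the functional would take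
  -- the value `1`.
  have h1 := dividedDiff_eq_time (θ₀ := fun i => k i ^ 3) hk (t := 1) g (p := 0) (v := 0)
    (fun a => by simp [phase])
  rw [h] at h1
  simp at h1

/-- For all but finitely many times the situation is generic. -/
theorem finite_setOf_not_isGeneric (hM : 0 < M) (hMN : M ≤ N) {k : Fin N → ℝ}
    (hk : Function.Injective k) (θ₀ : Fin N → ℝ) : {t : ℝ | ¬ IsGeneric M k θ₀ t}.Finite := by
  refine (Set.finite_range fun g : Fin 4 ↪ Fin N => dividedDiff k g θ₀).subset fun t ht => ?_
  obtain ⟨g, p, v, h⟩ := exists_four_of_not_isGeneric hM hMN ht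
  exact ⟨g, dividedDiff_eq_time hk g h⟩

/-- For almost all phase constants the situation is generic. -/
theorem volume_setOf_not_isGeneric (hM : 0 < M) (hMN : M ≤ N) {k : Fin N → ℝ}
    (hk : Function.Injective k) (t : ℝ) :
    MeasureTheory.volume {θ₀ : Fin N → ℝ | ¬ IsGeneric M k θ₀ t} = 0 := by
  have hsub : {θ₀ : Fin N → ℝ | ¬ IsGeneric M k θ₀ t} ⊆
      ⋃ g : Fin 4 ↪ Fin N, {θ₀ | dividedDiff k g θ₀ = t} := fun θ₀ hθ => by
    obtain ⟨g, p, v, h⟩ := exists_four_of_not_isGeneric hM hMN hθ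
    exact Set.mem_iUnion.2 ⟨g, dividedDiff_eq_time hk g h⟩
  refine MeasureTheory.measure_mono_null hsub (MeasureTheory.measure_iUnion_null fun g => ?_)
  let H : AffineSubspace ℝ (Fin N → ℝ) :=
    { carrier := {θ₀ | dividedDiff k g θ₀ = t}
      smul_vsub_vadd_mem' := fun c x y z hx hy hz => by
        rw [Set.mem_ofPred_eq] at hx hy hz ⊢
        simp [hx, hy, hz] }
  refine MeasureTheory.Measure.addHaar_affineSubspace MeasureTheory.volume H fun htop => ?_
  have hall : ∀ x, dividedDiff k g x = t := fun x => by
    have : x ∈ H := by rw [htop]; trivial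
    exact this
  apply dividedDiff_ne_zero hk g
  ext x
  have h0 := hall 0
  rw [map_zero] at h0
  simp only [LinearMap.comp_apply, LinearMap.zero_apply, hall, ← h0]

end Generic

/-! ### Counting half-lines along a line -/

section Telescoping

variable {ι : Type*} [DecidableEq ι]

/-- The number of half-lines containing the point `x`, where `m ∈ S` stands for the half-line
above `y m` if `m` is out, and below `y m` otherwise. -/
def halfLineCount (S : Finset ι) (out : ι → Prop) [DecidablePred out] (y : ι → ℝ) (x : ℝ) : ℕ :=
  (S.filter fun m => (out m ∧ y m < x) ∨ (¬ out m ∧ x < y m)).card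

/-- Telescoping along a line: the number of half-lines changes by one at each end point. -/
theorem sum_halfLineCount (S : Finset ι) (out : ι → Prop) [DecidablePred out] (y : ι → ℝ)
    (hy : Set.InjOn y S) (φ : ℕ → ℤ) :
    ∑ m ∈ S, (if out m then (1 : ℤ) else -1) *
      (φ (halfLineCount S out y (y m) + 1) - φ (halfLineCount S out y (y m))) =
      φ (S.filter out).card - φ (S.filter fun m => ¬ out m).card := by
  induction S using Finset.induction_on_max_value y generalizing φ with
  | empty => simp
  | insert a S ha hmax ih =>
    have hlt : ∀ m ∈ S, y m < y a := fun m hm => lt_of_le_of_ne (hmax m hm) fun e =>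
      ha (hy (Finset.mem_insert_of_mem hm) (Finset.mem_insert_self a S) e ▸ hm)
    have hyS : Set.InjOn y S := hy.mono (by simp)
    have htop : halfLineCount (insert a S) out y (y a) = (S.filter out).card := by
      unfold halfLineCount
      congr 1
      ext m
      simp only [Finset.mem_filter, Finset.mem_insert]
      constructor
      · rintro ⟨rfl | hm, h | h⟩
        · exact absurd h.2 (lt_irrefl _)
        · exact absurd h.2 (lt_irrefl _)
        · exact ⟨hm, h.1⟩
        · exact absurd h.2 (hlt m hm).not_gt
      · rintro ⟨hm, h⟩
        exact ⟨Or.inr hm, Or.inl ⟨h, hlt m hm⟩⟩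
    rw [Finset.sum_insert ha, htop, Finset.filter_insert, Finset.filter_insert]
    -- If `a` is out, its half-line contains none of the lower end points. Otherwise it contains all
    -- of them and raises their counts by one, which is absorbed by shifting `φ`.
    by_cases hout : out a
    · have hrest : ∀ m ∈ S, halfLineCount (insert a S) out y (y m) =
          halfLineCount S out y (y m) := fun m hm => by
        unfold halfLineCount
        rw [Finset.filter_insert, if_neg]
        simp [hout, (hlt m hm).le]
      rw [Finset.sum_congr rfl fun m hm => by rw [hrest m hm], ih hyS]
      simp only [hout, if_true, not_true, if_false]
      rw [Finset.card_insert_of_notMem (by simp [ha])]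
      ring
    · have hrest : ∀ m ∈ S, halfLineCount (insert a S) out y (y m) =
          halfLineCount S out y (y m) + 1 := fun m hm => by
        unfold halfLineCount
        rw [Finset.filter_insert, if_pos (Or.inr ⟨hout, hlt m hm⟩),
          Finset.card_insert_of_notMem (by simp [ha])]
      rw [Finset.sum_congr rfl fun m hm => by rw [hrest m hm], ih hyS fun n => φ (n + 1)]
      simp only [hout, if_true, not_false_iff, if_false]
      rw [Finset.card_insert_of_notMem (by simp [ha])]
      ring

end Telescoping

/-! ### Summation over pairs and triples of indices -/

section Sums

variable {N : ℕ}

/-- Summing a symmetric function of triples over all pairs `i < j` and all third indices `m`, with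
a minus sign if `m` lies in between, counts each triple once. -/
theorem sum_pairs_sign (g : Fin N → Fin N → Fin N → ℤ)
    (h1 : ∀ i j l, i < j → j < l → g j l i = g i j l)
    (h2 : ∀ i j l, i < j → j < l → g i l j = g i j l) :
    ∑ i, ∑ j, (if i < j then ∑ m ∈ (Finset.univ.erase i).erase j,
      (if j < m ∨ m < i then (1 : ℤ) else -1) * g i j m else 0) =
    ∑ i, ∑ j, ∑ l, if i < j ∧ j < l then g i j l else 0 := by
  have e1 : ∑ i : Fin N, ∑ j : Fin N, ∑ m : Fin N, (if m < i ∧ i < j then g i j m else 0) =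
      ∑ i, ∑ j, ∑ l, if i < j ∧ j < l then g i j l else 0 := by
    rw [Finset.sum_congr rfl fun i _ => Finset.sum_comm, Finset.sum_comm]
    refine Finset.sum_congr rfl fun i _ => Finset.sum_congr rfl fun j _ =>
      Finset.sum_congr rfl fun l _ => ?_
    split_ifs with h
    · exact h1 i j l h.1 h.2
    · rfl
  have e2 : ∑ i : Fin N, ∑ j : Fin N, ∑ m : Fin N, (if i < m ∧ m < j then g i j m else 0) =
      ∑ i, ∑ j, ∑ l, if i < j ∧ j < l then g i j l else 0 := by
    rw [Finset.sum_congr rfl fun i _ => Finset.sum_comm]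
    refine Finset.sum_congr rfl fun i _ => Finset.sum_congr rfl fun j _ =>
      Finset.sum_congr rfl fun l _ => ?_
    split_ifs with h
    · exact h2 i j l h.1 h.2
    · rfl
  have e3 : ∀ i j : Fin N, (if i < j then ∑ m ∈ (Finset.univ.erase i).erase j,
      (if j < m ∨ m < i then (1 : ℤ) else -1) * g i j m else 0) =
      (∑ m, if i < j ∧ j < m then g i j m else 0) + (∑ m, if m < i ∧ i < j then g i j m else 0) -
        ∑ m, if i < m ∧ m < j then g i j m else 0 := by
    intro i j
    rw [← Finset.sum_add_distrib, ← Finset.sum_sub_distrib]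
    split_ifs with hij
    · have : (Finset.univ.erase i).erase j =
          Finset.univ.filter fun m : Fin N => m ≠ i ∧ m ≠ j := by
        ext m; simp [and_comm]
      rw [this, Finset.sum_filter]
      refine Finset.sum_congr rfl fun m _ => ?_
      split_ifs <;> omega
    · rw [Finset.sum_eq_zero]
      intro m _
      split_ifs <;> omega
  simp only [e3, Finset.sum_sub_distrib, Finset.sum_add_distrib]
  rw [e1, e2]
  ring

/-- For fixed `j` the number `j - i - 1` of intermediate indices takes each value below `j` once. -/
theorem sum_pairs_sub (h : ℕ → ℤ) :
    ∑ i : Fin N, ∑ j : Fin N, (if i < j then h (j - i - 1) else 0) =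
      ∑ j ∈ Finset.range N, ∑ e ∈ Finset.range j, h e := by
  rw [Finset.sum_comm, ← Fin.sum_univ_eq_sum_range fun j => ∑ e ∈ Finset.range j, h e]
  refine Finset.sum_congr rfl fun j _ => ?_
  rw [← Finset.sum_range_reflect, Finset.sum_ite, Finset.sum_const_zero, add_zero]
  refine Finset.sum_bij (fun i _ => (i : ℕ)) (fun i hi => ?_) (fun i _ i' _ e => Fin.ext e)
    (fun i hi => ?_) fun i hi => ?_
  · simpa using hi
  · have := Finset.mem_range.1 hi
    exact ⟨⟨i, by omega⟩, Finset.mem_filter.2 ⟨Finset.mem_univ _, this⟩, rfl⟩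
  · congr 1; omega

/-- The count of pairs that comes out of the telescoping. -/
theorem sum_range_threshold (D M : ℕ) :
    ∑ j ∈ Finset.range (D + (M + 1)), ∑ e ∈ Finset.range j,
      ((if M ≤ D + M - 1 - e then (1 : ℤ) else 0) - if M ≤ e then 1 else 0) = M * D := by
  have hA : ∀ j ∈ Finset.range (D + (M + 1)), ∑ e ∈ Finset.range j,
      ((if M ≤ D + M - 1 - e then (1 : ℤ) else 0) - if M ≤ e then 1 else 0) =
      (min j D : ℕ) - ((j - M : ℕ) : ℤ) := by
    intro j hj
    replace hj := Finset.mem_range.1 hj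
    induction j with
    | zero => simp
    | succ j ih =>
      rw [Finset.sum_range_succ, ih (by omega)]
      split_ifs <;> omega
  rw [Finset.sum_congr rfl hA, Finset.sum_sub_distrib]
  have h1 : ∑ j ∈ Finset.range (D + (M + 1)), ((min j D : ℕ) : ℤ) =
      ∑ j ∈ Finset.range D, (j : ℤ) + (M + 1) * D := by
    rw [Finset.sum_range_add]
    congr 1
    · exact Finset.sum_congr rfl fun j hj => by
        rw [min_eq_left (Finset.mem_range.1 hj).le]
    · simp
  have h2 : ∑ j ∈ Finset.range (D + (M + 1)), ((j - M : ℕ) : ℤ) =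
      ∑ j ∈ Finset.range D, (j : ℤ) + D := by
    rw [show D + (M + 1) = M + (D + 1) by ring, Finset.sum_range_add, Finset.sum_range_succ',
      Finset.sum_eq_zero fun j hj => by
        rw [Nat.sub_eq_zero_of_le (Finset.mem_range.1 hj).le, Nat.cast_zero]]
    simp [Finset.sum_add_distrib]
  rw [h1, h2]; ring

end Sums

/-! ### Vertices of three phases and the count of those of given depth -/

section Vertex

variable {N M : ℕ} {k θ₀ : Fin N → ℝ} {t : ℝ}

/-- The second divided difference of `θ₀ - k³ t` at three wave numbers. -/
def secondDiff (k θ₀ : Fin N → ℝ) (t : ℝ) (i j l : Fin N) : ℝ :=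
  (θ₀ i - k i ^ 3 * t) / ((k i - k j) * (k i - k l)) +
  (θ₀ j - k j ^ 3 * t) / ((k j - k i) * (k j - k l)) +
  (θ₀ l - k l ^ 3 * t) / ((k l - k i) * (k l - k j))

/-- The point at which three phases agree. -/
def vertex (k θ₀ : Fin N → ℝ) (t : ℝ) (i j l : Fin N) : ℝ × ℝ :=
  (-(k i + k j) * secondDiff k θ₀ t i j l +
    ((θ₀ i - k i ^ 3 * t) - (θ₀ j - k j ^ 3 * t)) / (k i - k j), -secondDiff k θ₀ t i j l)

/-- This is the remainder of interpolation in `k` at the nodes `k i` and `k j`: the node product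
times the second divided difference of the phases. The `x` term contributes nothing to the latter
and the `y` term contributes `p.2`. -/
theorem phase_sub_phase (hk : Function.Injective k) {i j m : Fin N} (hij : i ≠ j) (him : i ≠ m)
    (hjm : j ≠ m) {p : ℝ × ℝ} (h : phase k θ₀ t p i = phase k θ₀ t p j) :
    phase k θ₀ t p m - phase k θ₀ t p i =
      (k m - k i) * (k m - k j) * (p.2 + secondDiff k θ₀ t i j m) := by
  have h1 : k i - k j ≠ 0 := sub_ne_zero.2 (hk.ne hij)
  have h2 : k i - k m ≠ 0 := sub_ne_zero.2 (hk.ne him)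
  have h3 : k j - k m ≠ 0 := sub_ne_zero.2 (hk.ne hjm)
  have hx : θ₀ i = θ₀ j - k j * p.1 + k j ^ 2 * p.2 - k j ^ 3 * t + k i * p.1 - k i ^ 2 * p.2 +
      k i ^ 3 * t := by
    unfold phase at h; linarith
  unfold phase secondDiff
  rw [← neg_sub (k i) (k j), ← neg_sub (k i) (k m), ← neg_sub (k j) (k m), hx]
  field_simp
  ring

theorem phase_vertex_snd (hk : Function.Injective k) {i j : Fin N} (hij : i ≠ j) (l : Fin N) :
    phase k θ₀ t (vertex k θ₀ t i j l) i = phase k θ₀ t (vertex k θ₀ t i j l) j := by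
  have h1 : k i - k j ≠ 0 := sub_ne_zero.2 (hk.ne hij)
  unfold phase vertex
  field_simp
  ring

theorem phase_vertex_thd (hk : Function.Injective k) {i j l : Fin N} (hij : i ≠ j) (hil : i ≠ l)
    (hjl : j ≠ l) :
    phase k θ₀ t (vertex k θ₀ t i j l) l = phase k θ₀ t (vertex k θ₀ t i j l) i := by
  have h := phase_sub_phase hk hij hil hjl (phase_vertex_snd (θ₀ := θ₀) (t := t) hk hij l)
  have e : (vertex k θ₀ t i j l).2 + secondDiff k θ₀ t i j l = 0 := by simp [vertex]
  rw [e, mul_zero] at h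
  linarith

theorem eq_vertex (hk : Function.Injective k) {i j l : Fin N} (hij : i ≠ j) (hil : i ≠ l)
    (hjl : j ≠ l) {p : ℝ × ℝ} (h1 : phase k θ₀ t p i = phase k θ₀ t p j)
    (h2 : phase k θ₀ t p i = phase k θ₀ t p l) : p = vertex k θ₀ t i j l := by
  have e := phase_sub_phase hk hij hil hjl h1
  rw [h2, sub_self, eq_comm, mul_eq_zero, or_iff_right (mul_ne_zero
    (sub_ne_zero.2 (hk.ne hil.symm)) (sub_ne_zero.2 (hk.ne hjl.symm)))] at e
  have hy : p.2 = -secondDiff k θ₀ t i j l := by linarith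
  have hd : k i - k j ≠ 0 := sub_ne_zero.2 (hk.ne hij)
  refine Prod.ext ?_ hy
  have h3 : (k i - k j) * p.1 = (k i ^ 2 - k j ^ 2) * p.2 +
      ((θ₀ i - k i ^ 3 * t) - (θ₀ j - k j ^ 3 * t)) := by
    unfold phase at h1; linarith
  have h4 : p.1 = ((k i ^ 2 - k j ^ 2) * p.2 +
      ((θ₀ i - k i ^ 3 * t) - (θ₀ j - k j ^ 3 * t))) / (k i - k j) := by
    rw [← h3]; field_simp
  rw [h4, hy]
  simp only [vertex]
  field_simp
  ring

theorem vertex_swap (hk : Function.Injective k) {i j l : Fin N} (hij : i ≠ j) (hil : i ≠ l)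
    (hjl : j ≠ l) : vertex k θ₀ t i l j = vertex k θ₀ t i j l :=
  eq_vertex hk hij hil hjl (phase_vertex_thd hk hil hij hjl.symm).symm
    (phase_vertex_snd hk hil j)

theorem vertex_rotate (hk : Function.Injective k) {i j l : Fin N} (hij : i ≠ j) (hil : i ≠ l)
    (hjl : j ≠ l) : vertex k θ₀ t j l i = vertex k θ₀ t i j l :=
  eq_vertex hk hij hil hjl (phase_vertex_thd hk hjl hij.symm hil.symm)
    ((phase_vertex_thd hk hjl hij.symm hil.symm).trans (phase_vertex_snd hk hjl i))

/-- The common value of the three phases at the vertex. -/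
def vertexValue (k θ₀ : Fin N → ℝ) (t : ℝ) (i j l : Fin N) : ℝ :=
  phase k θ₀ t (vertex k θ₀ t i j l) i

/-- The number of phases exceeding the three coincident ones at the vertex. -/
def vertexDepth (k θ₀ : Fin N → ℝ) (t : ℝ) (i j l : Fin N) : ℕ :=
  (above k θ₀ t (vertex k θ₀ t i j l) (vertexValue k θ₀ t i j l)).card

theorem vertexDepth_swap (hk : Function.Injective k) {i j l : Fin N} (hij : i ≠ j) (hil : i ≠ l)
    (hjl : j ≠ l) : vertexDepth k θ₀ t i l j = vertexDepth k θ₀ t i j l := by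
  unfold vertexDepth vertexValue
  rw [vertex_swap hk hij hil hjl]

theorem vertexDepth_rotate (hk : Function.Injective k) {i j l : Fin N} (hij : i ≠ j) (hil : i ≠ l)
    (hjl : j ≠ l) : vertexDepth k θ₀ t j l i = vertexDepth k θ₀ t i j l := by
  unfold vertexDepth vertexValue
  rw [vertex_rotate hk hij hil hjl, phase_vertex_snd hk hij]

/-- The value of a further phase at a vertex moves linearly in time. -/
theorem phase_vertex_sub_add (hk : Function.Injective k) {i j l m : Fin N} (hij : i ≠ j)
    (hil : i ≠ l) (hjl : j ≠ l) (him : i ≠ m) (hjm : j ≠ m) (ε : ℝ) :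
    phase k θ₀ (t + ε) (vertex k θ₀ (t + ε) i j l) m - vertexValue k θ₀ (t + ε) i j l =
      phase k θ₀ t (vertex k θ₀ t i j l) m - vertexValue k θ₀ t i j l -
        ε * ((k m - k i) * (k m - k j) * (k m - k l)) := by
  unfold vertexValue
  rw [phase_sub_phase hk hij him hjm (phase_vertex_snd hk hij l),
    phase_sub_phase hk hij him hjm (phase_vertex_snd hk hij l)]
  have h1 : k i - k j ≠ 0 := sub_ne_zero.2 (hk.ne hij)
  have h2 : k i - k m ≠ 0 := sub_ne_zero.2 (hk.ne him)
  have h3 : k j - k m ≠ 0 := sub_ne_zero.2 (hk.ne hjm)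
  have h4 : k i - k l ≠ 0 := sub_ne_zero.2 (hk.ne hil)
  have h5 : k j - k l ≠ 0 := sub_ne_zero.2 (hk.ne hjl)
  have key : ∀ n, i ≠ n → j ≠ n →
      secondDiff k θ₀ (t + ε) i j n = secondDiff k θ₀ t i j n - ε * (k i + k j + k n) := by
    intro n hin hjn
    have h6 : k i - k n ≠ 0 := sub_ne_zero.2 (hk.ne hin)
    have h7 : k j - k n ≠ 0 := sub_ne_zero.2 (hk.ne hjn)
    unfold secondDiff
    rw [← neg_sub (k i) (k j), ← neg_sub (k i) (k n), ← neg_sub (k j) (k n)]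
    field_simp
    ring
  simp only [vertex, key m him hjm, key l hil hjl]
  ring

/-- No four phases meet. -/
def IsFullyGeneric (k θ₀ : Fin N → ℝ) (t : ℝ) : Prop :=
  ∀ i j l m, i ≠ j → i ≠ l → j ≠ l → i ≠ m → j ≠ m → l ≠ m →
    phase k θ₀ t (vertex k θ₀ t i j l) m ≠ vertexValue k θ₀ t i j l

theorem phase_vertex_sub (hk : Function.Injective k) {i j l m : Fin N} (hij : i ≠ j)
    (him : i ≠ m) (hjm : j ≠ m) :
    phase k θ₀ t (vertex k θ₀ t i j l) m - vertexValue k θ₀ t i j l =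
      (k m - k i) * (k m - k j) * (-secondDiff k θ₀ t i j l - -secondDiff k θ₀ t i j m) := by
  rw [vertexValue, phase_sub_phase hk hij him hjm (phase_vertex_snd hk hij l)]
  simp only [vertex]
  ring

/-- The line where phases `i` and `j` agree is parametrized by height. The node product `(k m - k i)
* (k m - k j)` is positive for `m` outside the interval from `i` to `j` and negative inside, so
phase `m` is larger above, respectively below, its crossing height. -/
theorem vertexDepth_eq_halfLineCount (hk : StrictMono k) {i j l : Fin N} (hij : i < j)
    (hil : i ≠ l) (hjl : j ≠ l) :
    vertexDepth k θ₀ t i j l = halfLineCount ((Finset.univ.erase i).erase j)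
      (fun m => j < m ∨ m < i) (fun m => -secondDiff k θ₀ t i j m)
      (-secondDiff k θ₀ t i j l) := by
  unfold vertexDepth halfLineCount
  congr 1
  ext m
  rw [mem_above, Finset.mem_filter, Finset.mem_erase, Finset.mem_erase]
  by_cases hmi : m = i
  · subst hmi
    simp [vertexValue]
  by_cases hmj : m = j
  · subst hmj
    simp [vertexValue, phase_vertex_snd hk.injective hij.ne]
  have hs := phase_vertex_sub (θ₀ := θ₀) (t := t) (l := l) hk.injective hij.ne (Ne.symm hmi)
    (Ne.symm hmj)
  rw [← sub_pos, hs]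
  simp only [hmi, hmj, ne_eq, not_false_eq_true, Finset.mem_univ, true_and, and_self]
  by_cases hout : j < m ∨ m < i
  · have hpos : 0 < (k m - k i) * (k m - k j) := by
      rcases hout with h | h
      · exact mul_pos (sub_pos.2 (hk (hij.trans h))) (sub_pos.2 (hk h))
      · exact mul_pos_of_neg_of_neg (sub_neg.2 (hk h)) (sub_neg.2 (hk (h.trans hij)))
    rw [mul_pos_iff_of_pos_left hpos, sub_pos]
    simp [hout]
  · have hlt : i < m ∧ m < j := by
      rw [not_or, not_lt, not_lt] at hout
      exact ⟨lt_of_le_of_ne hout.2 (Ne.symm hmi), lt_of_le_of_ne hout.1 hmj⟩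
    have hneg : (k m - k i) * (k m - k j) < 0 :=
      mul_neg_of_pos_of_neg (sub_pos.2 (hk hlt.1)) (sub_neg.2 (hk hlt.2))
    simp only [hout, false_and, not_false_eq_true, true_and, false_or]
    constructor
    · intro h
      by_contra hc
      rw [not_lt] at hc
      exact absurd h (not_lt.2 (mul_nonpos_of_nonpos_of_nonneg hneg.le (sub_nonneg.2 hc)))
    · intro h
      exact mul_pos_of_neg_of_neg hneg (sub_neg.2 h)

/-- The triples `i < j < l` below exactly `d` phases. -/
def triplesOfDepth (k θ₀ : Fin N → ℝ) (t : ℝ) (d : ℕ) : Finset (Fin N × Fin N × Fin N) :=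
  Finset.univ.filter fun T => T.1 < T.2.1 ∧ T.2.1 < T.2.2 ∧ vertexDepth k θ₀ t T.1 T.2.1 T.2.2 = d

theorem card_between {i j : Fin N} (hij : i < j) :
    (((Finset.univ.erase i).erase j).filter fun m => ¬ (j < m ∨ m < i)).card =
      (j : ℕ) - i - 1 := by
  have : (((Finset.univ.erase i).erase j).filter fun m => ¬ (j < m ∨ m < i)) =
      Finset.Ioo i j := by
    ext m
    simp only [Finset.mem_filter, Finset.mem_erase, Finset.mem_univ, Finset.mem_Ioo, and_true]
    omega
  rw [this, Fin.card_Ioo]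

theorem card_outside {i j : Fin N} (hij : i < j) :
    (((Finset.univ.erase i).erase j).filter fun m => j < m ∨ m < i).card =
      N - 2 - ((j : ℕ) - i - 1) := by
  have h := Finset.card_filter_add_card_filter_not (s := (Finset.univ.erase i).erase j)
    (fun m => j < m ∨ m < i)
  rw [card_between hij, Finset.card_erase_of_mem (Finset.mem_erase.2 ⟨hij.ne', Finset.mem_univ _⟩),
    Finset.card_erase_of_mem (Finset.mem_univ _), Finset.card_univ, Fintype.card_fin] at h
  omega

/-- If no four phases meet, the number of vertices of each depth depends only on `N`. -/
theorem card_triplesOfDepth_of_isFullyGeneric (hk : StrictMono k) (D d : ℕ)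
    (hN : N = D + (d + 2)) (hgen : IsFullyGeneric k θ₀ t) :
    (triplesOfDepth k θ₀ t d).card = (d + 1) * D := by
  have hinj := hk.injective
  -- A step function, so that `φ (n + 1) - φ n` is the indicator of `n = d`.
  let φ : ℕ → ℤ := fun n => if d + 1 ≤ n then 1 else 0
  let g : Fin N → Fin N → Fin N → ℤ := fun i j l =>
    φ (vertexDepth k θ₀ t i j l + 1) - φ (vertexDepth k θ₀ t i j l)
  have hg1 : ∀ i j l, i < j → j < l → g j l i = g i j l := fun i j l hij hjl => by
    simp only [g, vertexDepth_rotate hinj hij.ne (hij.trans hjl).ne hjl.ne]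
  have hg2 : ∀ i j l, i < j → j < l → g i l j = g i j l := fun i j l hij hjl => by
    simp only [g, vertexDepth_swap hinj hij.ne (hij.trans hjl).ne hjl.ne]
  have hcount : ((triplesOfDepth k θ₀ t d).card : ℤ) =
      ∑ i, ∑ j, ∑ l, if i < j ∧ j < l then g i j l else 0 := by
    rw [triplesOfDepth, Finset.card_filter, Nat.cast_sum, ← Finset.univ_product_univ,
      Finset.sum_product]
    refine Finset.sum_congr rfl fun i _ => ?_
    rw [← Finset.univ_product_univ, Finset.sum_product]
    refine Finset.sum_congr rfl fun j _ => Finset.sum_congr rfl fun l _ => ?_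
    simp only [g, φ]
    split_ifs <;> omega
  have hline : ∀ i j : Fin N, i < j → ∑ m ∈ (Finset.univ.erase i).erase j,
      (if j < m ∨ m < i then (1 : ℤ) else -1) * g i j m =
      φ (N - 2 - ((j : ℕ) - i - 1)) - φ ((j : ℕ) - i - 1) := by
    intro i j hij
    rw [← card_outside hij, ← card_between hij]
    rw [← sum_halfLineCount _ _ (fun m => -secondDiff k θ₀ t i j m)]
    · refine Finset.sum_congr rfl fun m hm => ?_
      rw [Finset.mem_erase, Finset.mem_erase] at hm
      simp only [g, vertexDepth_eq_halfLineCount hk hij (Ne.symm hm.2.1) (Ne.symm hm.1)]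
    -- Two crossings at the same height would be a meeting of four phases.
    · intro l hl m hm hlm
      by_contra hne
      rw [Finset.mem_coe, Finset.mem_erase, Finset.mem_erase] at hl hm
      refine hgen i j l m hij.ne (Ne.symm hl.2.1) (Ne.symm hl.1) (Ne.symm hm.2.1) (Ne.symm hm.1)
        hne ?_
      have hs := phase_vertex_sub (θ₀ := θ₀) (t := t) (l := l) hinj hij.ne (Ne.symm hm.2.1)
        (Ne.symm hm.1)
      simp only at hlm
      rw [hlm, sub_self, mul_zero] at hs
      linarith
  have htotal := sum_pairs_sign g hg1 hg2
  rw [← hcount] at htotal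
  have hpairs : ∑ i : Fin N, ∑ j : Fin N, (if i < j then ∑ m ∈ (Finset.univ.erase i).erase j,
      (if j < m ∨ m < i then (1 : ℤ) else -1) * g i j m else 0) =
      ∑ i : Fin N, ∑ j : Fin N, (if i < j then (fun e => φ (N - 2 - e) - φ e) ((j : ℕ) - i - 1)
        else 0) := by
    refine Finset.sum_congr rfl fun i _ => Finset.sum_congr rfl fun j _ => ?_
    split_ifs with hij
    · rw [hline i j hij]
    · rfl
  rw [hpairs, sum_pairs_sub fun e => φ (N - 2 - e) - φ e] at htotal
  have hthr := sum_range_threshold D (d + 1)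
  have hN' : N = D + (d + 1 + 1) := hN
  rw [← hN'] at hthr
  have hN2 : D + (d + 1) - 1 = N - 2 := by omega
  rw [hN2] at hthr
  rw [hthr] at htotal
  exact_mod_cast htotal.symm

/-- At almost every nearby later time no four phases meet, and in the generic situation the
vertices at the birth of regions are the same. -/
theorem card_triplesOfDepth (hk : StrictMono k) (D d : ℕ) (hN : N = D + (d + 2))
    (hgen : IsGeneric (d + 2) k θ₀ t) : (triplesOfDepth k θ₀ t d).card = (d + 1) * D := by
  have hinj := hk.injective
  -- Each gap between a further phase and a vertex value changes by `-ε * P` with `P ≠ 0`. For small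
  -- `ε > 0` a non-zero gap keeps its sign and a zero gap becomes non-zero.
  have hev : ∀ᶠ ε in 𝓝[>] (0 : ℝ), ∀ i j l m : Fin N, i ≠ j → i ≠ l → j ≠ l → i ≠ m → j ≠ m →
      l ≠ m → phase k θ₀ (t + ε) (vertex k θ₀ (t + ε) i j l) m ≠ vertexValue k θ₀ (t + ε) i j l ∧
      (phase k θ₀ t (vertex k θ₀ t i j l) m < vertexValue k θ₀ t i j l →
        phase k θ₀ (t + ε) (vertex k θ₀ (t + ε) i j l) m < vertexValue k θ₀ (t + ε) i j l) ∧
      (vertexValue k θ₀ t i j l < phase k θ₀ t (vertex k θ₀ t i j l) m →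
        vertexValue k θ₀ (t + ε) i j l < phase k θ₀ (t + ε) (vertex k θ₀ (t + ε) i j l) m) := by
    simp only [Filter.eventually_all]
    intro i j l m hij hil hjl him hjm hlm
    set P := (k m - k i) * (k m - k j) * (k m - k l) with hP
    have hP0 : P ≠ 0 := mul_ne_zero (mul_ne_zero (sub_ne_zero.2 (hinj.ne him.symm))
      (sub_ne_zero.2 (hinj.ne hjm.symm))) (sub_ne_zero.2 (hinj.ne hlm.symm))
    set G := phase k θ₀ t (vertex k θ₀ t i j l) m - vertexValue k θ₀ t i j l with hG
    have hgap := fun ε => phase_vertex_sub_add (θ₀ := θ₀) (t := t) hinj hij hil hjl him hjm ε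
    have hlim : Filter.Tendsto (fun ε : ℝ => G - ε * P) (𝓝[>] 0) (𝓝 G) := by
      have : Filter.Tendsto (fun ε : ℝ => G - ε * P) (𝓝 0) (𝓝 (G - 0 * P)) :=
        (continuous_const.sub (continuous_id.mul continuous_const)).tendsto 0
      rw [zero_mul, sub_zero] at this
      exact this.mono_left nhdsWithin_le_nhds
    rcases lt_trichotomy G 0 with h | h | h
    · filter_upwards [hlim.eventually (gt_mem_nhds h)] with ε hε
      have := hgap ε
      refine ⟨fun e => ?_, fun _ => ?_, fun e => ?_⟩ <;> linarith
    · filter_upwards [self_mem_nhdsWithin] with ε hε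
      have := hgap ε
      have hεP : ε * P ≠ 0 := mul_ne_zero (ne_of_gt hε) hP0
      refine ⟨fun e => hεP ?_, fun e => ?_, fun e => ?_⟩ <;> linarith
    · filter_upwards [hlim.eventually (lt_mem_nhds h)] with ε hε
      have := hgap ε
      refine ⟨fun e => ?_, fun e => ?_, fun _ => ?_⟩ <;> linarith
  obtain ⟨ε, hε⟩ := hev.exists
  rw [← card_triplesOfDepth_of_isFullyGeneric (t := t + ε) hk D d hN
    fun i j l m hij hil hjl him hjm hlm => (hε i j l m hij hil hjl him hjm hlm).1]
  congr 1
  refine Finset.filter_congr fun T _ => and_congr_right fun hij => and_congr_right fun hjl => ?_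
  obtain ⟨i, j, l⟩ := T
  simp only at hij hjl ⊢
  have hil := hij.trans hjl
  set V := vertex k θ₀ t i j l with hV
  set v := vertexValue k θ₀ t i j l with hv
  have hvi : phase k θ₀ t V i = v := rfl
  have hvj : phase k θ₀ t V j = v := (phase_vertex_snd hinj hij.ne l).symm
  have hvl : phase k θ₀ t V l = v := phase_vertex_thd hinj hij.ne hil.ne hjl.ne
  have hε' := hε i j l
  have hT : ({i, j, l} : Finset (Fin N)) ⊆ level k θ₀ t V v := by
    intro m hm
    simp only [Finset.mem_insert, Finset.mem_singleton] at hm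
    rcases hm with rfl | rfl | rfl <;> simpa
  have hTc : ({i, j, l} : Finset (Fin N)).card = 3 := Finset.card_eq_three.2
    ⟨i, j, l, hij.ne, hil.ne, hjl.ne, rfl⟩
  set A := above k θ₀ t V v with hA
  set A' := above k θ₀ (t + ε) (vertex k θ₀ (t + ε) i j l) (vertexValue k θ₀ (t + ε) i j l) with hA'
  have hnot : ∀ m ∈ A ∪ A', i ≠ m ∧ j ≠ m ∧ l ≠ m := by
    intro m hm
    rw [Finset.mem_union, hA, hA', mem_above, mem_above] at hm
    refine ⟨?_, ?_, ?_⟩ <;> rintro rfl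
    · rcases hm with hm | hm
      · exact hm.ne' hvi
      · exact lt_irrefl _ hm
    · rcases hm with hm | hm
      · exact hm.ne' hvj
      · exact hm.ne' (phase_vertex_snd hinj hij.ne l).symm
    · rcases hm with hm | hm
      · exact hm.ne' hvl
      · exact hm.ne' (phase_vertex_thd hinj hij.ne hil.ne hjl.ne)
  have hAA' : A ⊆ A' := fun m hm => by
    obtain ⟨h1, h2, h3⟩ := hnot m (Finset.mem_union_left _ hm)
    exact mem_above.2 ((hε' m hij.ne hil.ne hjl.ne h1 h2 h3).2.2 (mem_above.1 hm))
  have hA'A : A' ⊆ A ∪ (level k θ₀ t V v \ {i, j, l}) := fun m hm => by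
    obtain ⟨h1, h2, h3⟩ := hnot m (Finset.mem_union_right _ hm)
    rw [Finset.mem_union, Finset.mem_sdiff, mem_above, mem_level]
    rcases lt_trichotomy (phase k θ₀ t V m) v with h | h | h
    · exact absurd (mem_above.1 hm) ((hε' m hij.ne hil.ne hjl.ne h1 h2 h3).2.1 h).not_gt
    · exact Or.inr ⟨h, by simp [h1.symm, h2.symm, h3.symm]⟩
    · exact Or.inl h
  have hc1 := Finset.card_le_card hAA'
  have hc2 := (Finset.card_le_card hA'A).trans (Finset.card_union_le _ _)
  rw [Finset.card_sdiff_of_subset hT, hTc] at hc2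
  have hc3 := Finset.card_le_card hT
  rw [hTc] at hc3
  -- Only indices tied at `V` outside the triple can enter `A'`. In both directions below, the
  -- cardinalities satisfy these inequalities, so genericity excludes such indices.
  have hlev : A.card < d + 2 → d + 2 < A.card + (level k θ₀ t V v).card →
      (level k θ₀ t V v).card ≤ 3 := hgen.card_level_le V
  change A.card = d ↔ A'.card = d
  constructor
  · intro h
    have := hlev (by omega) (by omega)
    omega
  · intro h
    have := hlev (by omega) (by omega)
    omega

end Vertex

/-! ### Recession directions and contiguous index sets -/

section Direction

variable {N : ℕ}

/-- An unbounded set in a finite-dimensional space has a direction along which no linear functional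
that is bounded below on the set decreases. -/
theorem exists_recession_direction {E : Type*} [NormedAddCommGroup E] [NormedSpace ℝ E]
    [FiniteDimensional ℝ E] {A : Set E} (hA : ¬ Bornology.IsBounded A) :
    ∃ d : E, d ≠ 0 ∧ ∀ ℓ : E →L[ℝ] ℝ, ∀ b : ℝ, (∀ p ∈ A, b ≤ ℓ p) → 0 ≤ ℓ d := by
  have h : ∀ n : ℕ, ∃ p ∈ A, (n : ℝ) + 1 < ‖p‖ := by
    intro n
    by_contra hcon
    push Not at hcon
    exact hA (isBounded_iff_forall_norm_le.2 ⟨_, hcon⟩)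
  choose p hpA hp using h
  have hpos : ∀ n, 0 < ‖p n‖ := fun n => lt_trans (by positivity) (hp n)
  have hmem : ∀ n, ‖p n‖⁻¹ • p n ∈ Metric.sphere (0 : E) 1 := fun n => by
    rw [mem_sphere_zero_iff_norm, norm_smul, norm_inv, norm_norm, inv_mul_cancel₀ (hpos n).ne']
  obtain ⟨d, hd, ψ, hψ, hlim⟩ := (isCompact_sphere (0 : E) 1).tendsto_subseq hmem
  refine ⟨d, ?_, fun ℓ b hb => ?_⟩
  · rintro rfl
    simp at hd
  · have hinf : Filter.Tendsto (fun n => ‖p n‖) Filter.atTop Filter.atTop :=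
      Filter.tendsto_atTop_mono (fun n => ((lt_add_one (n : ℝ)).trans (hp n)).le)
        tendsto_natCast_atTop_atTop
    have h1 : Filter.Tendsto (fun n => ‖p (ψ n)‖⁻¹ * b) Filter.atTop (𝓝 (0 * b)) :=
      ((tendsto_inv_atTop_zero.comp hinf).comp hψ.tendsto_atTop).mul_const b
    have h2 := (ℓ.continuous.tendsto d).comp hlim
    rw [zero_mul] at h1
    refine le_of_tendsto_of_tendsto' h1 h2 fun n => ?_
    simp only [Function.comp_apply, map_smul, smul_eq_mul]
    exact mul_le_mul_of_nonneg_left (hb _ (hpA _)) (inv_nonneg.2 (hpos _).le)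

/-- The linear part of the phase. -/
def slope (k : Fin N → ℝ) (i : Fin N) : ℝ × ℝ →L[ℝ] ℝ :=
  (-k i) • ContinuousLinearMap.fst ℝ ℝ ℝ + k i ^ 2 • ContinuousLinearMap.snd ℝ ℝ ℝ

theorem slope_apply (k : Fin N → ℝ) (i : Fin N) (d : ℝ × ℝ) :
    slope k i d = -k i * d.1 + k i ^ 2 * d.2 := by
  simp [slope]

theorem phase_eq_slope (k θ₀ : Fin N → ℝ) (t : ℝ) (p : ℝ × ℝ) (i : Fin N) :
    phase k θ₀ t p i = slope k i p + (θ₀ i - k i ^ 3 * t) := by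
  rw [slope_apply, phase]; ring

theorem phase_add_smul (k θ₀ : Fin N → ℝ) (t : ℝ) (p d : ℝ × ℝ) (s : ℝ) (i : Fin N) :
    phase k θ₀ t (p + s • d) i = phase k θ₀ t p i + s * slope k i d := by
  rw [phase_eq_slope, phase_eq_slope, map_add, map_smul, smul_eq_mul]; ring

/-- A set of indices without gaps. -/
def IsContiguous (I : Finset (Fin N)) : Prop :=
  ∀ i j l, i < j → j < l → i ∈ I → l ∈ I → j ∈ I

/-- In a downward direction the slope is a concave quadratic in `k`. The choice of `u` makes it a
constant minus the parabola with zeros at the extreme wave numbers of `P`, and no index of `Q` lies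
between these extremes. -/
theorem exists_down_direction {k : Fin N → ℝ} (hk : StrictMono k) {P Q : Finset (Fin N)}
    (hPQ : Disjoint P Q) (h : ∀ i ∈ P, ∀ l ∈ P, ∀ j ∈ Q, i < j → ¬ j < l) :
    ∃ u : ℝ, ∀ i ∈ P, ∀ j ∈ Q, slope k j (u, -1) < slope k i (u, -1) := by
  rcases P.eq_empty_or_nonempty with rfl | hP
  · exact ⟨0, by simp⟩
  set a := P.min' hP
  set b := P.max' hP
  refine ⟨-(k a + k b), fun i hi j hj => ?_⟩
  have e : ∀ m, slope k m (-(k a + k b), -1) = k a * k b - (k m - k a) * (k m - k b) := fun m => by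
    rw [slope_apply]; ring
  have hi' : (k i - k a) * (k i - k b) ≤ 0 := mul_nonpos_of_nonneg_of_nonpos
    (sub_nonneg.2 (hk.monotone (P.min'_le i hi))) (sub_nonpos.2 (hk.monotone (P.le_max' i hi)))
  have hne : ∀ m ∈ P, m ≠ j := fun m hm e => Finset.disjoint_left.1 hPQ hm (e ▸ hj)
  have hj' : 0 < (k j - k a) * (k j - k b) := by
    rcases lt_or_gt_of_ne (hne a (P.min'_mem hP)) with hlt | hlt
    · have hbj : b < j := lt_of_le_of_ne
        (not_lt.1 (h a (P.min'_mem hP) b (P.max'_mem hP) j hj hlt)) (hne b (P.max'_mem hP))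
      exact mul_pos (sub_pos.2 (hk hlt)) (sub_pos.2 (hk hbj))
    · have hjb : j < b := hlt.trans_le (P.min'_le _ (P.max'_mem hP))
      exact mul_pos_of_neg_of_neg (sub_neg.2 (hk hlt)) (sub_neg.2 (hk hjb))
  rw [e, e]
  linarith

theorem exists_up_direction {k : Fin N → ℝ} (hk : StrictMono k) {P Q : Finset (Fin N)}
    (hPQ : Disjoint P Q) (h : ∀ i ∈ Q, ∀ l ∈ Q, ∀ j ∈ P, i < j → ¬ j < l) :
    ∃ u : ℝ, ∀ i ∈ P, ∀ j ∈ Q, slope k j (u, 1) < slope k i (u, 1) := by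
  obtain ⟨u, hu⟩ := exists_down_direction hk hPQ.symm h
  refine ⟨-u, fun i hi j hj => ?_⟩
  have e : ((-u, 1) : ℝ × ℝ) = -(u, -1) := by simp
  rw [e, map_neg, map_neg]
  exact neg_lt_neg (hu j hj i hi)

/-- For `d.2 < 0` the slope is strictly concave in `k`, and for `d.2 = 0` it is strictly monotone
because `d ≠ 0`. In neither case can a value in the middle be below or equal to both outer ones. -/
theorem isContiguous_of_direction {k : Fin N → ℝ} (hk : StrictMono k) {I : Finset (Fin N)}
    {d : ℝ × ℝ} (hd : d ≠ 0) (hd2 : d.2 ≤ 0)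
    (h : ∀ i ∈ I, ∀ j ∉ I, slope k j d ≤ slope k i d) : IsContiguous I := by
  intro i j l hij hjl hi hl
  by_contra hj
  have h1 := h i hi j hj
  have h2 := h l hl j hj
  rw [slope_apply, slope_apply] at h1 h2
  have e1 : -d.1 + (k j + k i) * d.2 ≤ 0 := by
    refine nonpos_of_mul_nonpos_right (a := k j - k i) ?_ (sub_pos.2 (hk hij))
    linarith [h1, (by ring : (k j - k i) * (-d.1 + (k j + k i) * d.2) =
      (-k j * d.1 + k j ^ 2 * d.2) - (-k i * d.1 + k i ^ 2 * d.2))]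
  have e2 : 0 ≤ -d.1 + (k j + k l) * d.2 := by
    refine nonneg_of_mul_nonneg_right (a := k l - k j) ?_ (sub_pos.2 (hk hjl))
    linarith [h2, (by ring : (k l - k j) * (-d.1 + (k j + k l) * d.2) =
      (-k l * d.1 + k l ^ 2 * d.2) - (-k j * d.1 + k j ^ 2 * d.2))]
  have hil := hk (hij.trans hjl)
  have e3 : 0 ≤ d.2 := by
    refine nonneg_of_mul_nonneg_right (a := k l - k i) ?_ (sub_pos.2 hil)
    linarith
  have e4 : d.2 = 0 := le_antisymm hd2 e3
  rw [e4] at e1 e2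
  exact hd (Prod.ext (by simp only [Prod.fst_zero]; linarith) e4)

end Direction

/-! ### Convex regions and their boundedness -/

section Region

variable {N : ℕ} {k θ₀ : Fin N → ℝ} {t : ℝ} {I : Finset (Fin N)}

theorem continuous_phase (k θ₀ : Fin N → ℝ) (t : ℝ) (i : Fin N) :
    Continuous fun p => phase k θ₀ t p i := by
  unfold phase; fun_prop

theorem isOpen_region (k θ₀ : Fin N → ℝ) (t : ℝ) (I : Finset (Fin N)) :
    IsOpen (region k θ₀ t I) := by
  have : region k θ₀ t I = ⋂ i ∈ I, ⋂ j ∈ Iᶜ, {p | phase k θ₀ t p j < phase k θ₀ t p i} := by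
    ext p; simp [region]
  rw [this]
  exact isOpen_biInter_finset fun i _ => isOpen_biInter_finset fun j _ =>
    isOpen_lt (continuous_phase k θ₀ t j) (continuous_phase k θ₀ t i)

theorem isClosed_closedRegion (k θ₀ : Fin N → ℝ) (t : ℝ) (I : Finset (Fin N)) :
    IsClosed (closedRegion k θ₀ t I) := by
  have : closedRegion k θ₀ t I =
      ⋂ i ∈ I, ⋂ j ∈ Iᶜ, {p | phase k θ₀ t p j ≤ phase k θ₀ t p i} := by
    ext p; simp [closedRegion]
  rw [this]
  exact isClosed_biInter fun i _ => isClosed_biInter fun j _ =>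
    isClosed_le (continuous_phase k θ₀ t j) (continuous_phase k θ₀ t i)

theorem convex_region (k θ₀ : Fin N → ℝ) (t : ℝ) (I : Finset (Fin N)) :
    Convex ℝ (region k θ₀ t I) := by
  intro p hp q hq a b ha hb hab i hi j hj
  have e : ∀ m, phase k θ₀ t (a • p + b • q) m = a * phase k θ₀ t p m + b * phase k θ₀ t q m := by
    intro m
    obtain rfl : a = 1 - b := by linarith
    simp only [phase, Prod.fst_add, Prod.snd_add, Prod.smul_fst, Prod.smul_snd, smul_eq_mul]
    ring
  rw [e, e]
  have h1 := hp i hi j hj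
  have h2 := hq i hi j hj
  rcases ha.eq_or_lt with rfl | ha
  · obtain rfl : b = 1 := by linarith
    linarith
  · exact add_lt_add_of_lt_of_le (mul_lt_mul_of_pos_left h1 ha)
      (mul_le_mul_of_nonneg_left h2.le hb)

/-- A small step in a direction that separates all ties leads into the open region. -/
theorem exists_add_smul_mem_region {p d : ℝ × ℝ} (hp : p ∈ closedRegion k θ₀ t I)
    (hd : ∀ i ∈ I, ∀ j ∉ I, phase k θ₀ t p j = phase k θ₀ t p i → slope k j d < slope k i d) :
    ∃ ε : ℝ, 0 < ε ∧ p + ε • d ∈ region k θ₀ t I := by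
  have hev : ∀ᶠ ε in 𝓝[>] (0 : ℝ), ∀ i, i ∈ I → ∀ j, j ∉ I →
      phase k θ₀ t (p + ε • d) j < phase k θ₀ t (p + ε • d) i := by
    simp only [Filter.eventually_all]
    intro i hi j hj
    rcases (hp i hi j hj).lt_or_eq with h | h
    · have hc : ∀ m, Continuous fun ε : ℝ => phase k θ₀ t (p + ε • d) m := fun m =>
        (continuous_phase k θ₀ t m).comp
          (continuous_const.add (continuous_id.smul continuous_const))
      have hopen : IsOpen {ε : ℝ | phase k θ₀ t (p + ε • d) j < phase k θ₀ t (p + ε • d) i} :=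
        isOpen_lt (hc j) (hc i)
      exact mem_nhdsWithin_of_mem_nhds (hopen.mem_nhds (by simpa using h))
    · filter_upwards [self_mem_nhdsWithin] with ε (hε : 0 < ε)
      rw [phase_add_smul, phase_add_smul, h]
      have := mul_lt_mul_of_pos_left (hd i hi j hj h) hε
      linarith
  obtain ⟨ε, hε, hpos⟩ := (hev.and self_mem_nhdsWithin).exists
  exact ⟨ε, hpos, fun i hi j hj => hε i hi j hj⟩

theorem add_smul_mem_region {p d : ℝ × ℝ} (hp : p ∈ region k θ₀ t I)
    (hd : ∀ i ∈ I, ∀ j ∉ I, slope k j d < slope k i d) {s : ℝ} (hs : 0 ≤ s) :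
    p + s • d ∈ region k θ₀ t I := fun i hi j hj => by
  rw [phase_add_smul, phase_add_smul]
  exact add_lt_add_of_lt_of_le (hp i hi j hj) (mul_le_mul_of_nonneg_left (hd i hi j hj).le hs)

theorem region_nonempty_of_direction {d : ℝ × ℝ}
    (hd : ∀ i ∈ I, ∀ j ∉ I, slope k j d < slope k i d) : (region k θ₀ t I).Nonempty := by
  have hev : ∀ᶠ s : ℝ in Filter.atTop, ∀ i, i ∈ I → ∀ j, j ∉ I →
      phase k θ₀ t ((0 : ℝ × ℝ) + s • d) j < phase k θ₀ t ((0 : ℝ × ℝ) + s • d) i := by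
    simp only [Filter.eventually_all]
    intro i hi j hj
    have h := sub_pos.2 (hd i hi j hj)
    filter_upwards [(Filter.tendsto_id.atTop_mul_const h).eventually_gt_atTop
      (phase k θ₀ t 0 j - phase k θ₀ t 0 i)] with s hs
    rw [phase_add_smul, phase_add_smul]
    simp only [id] at hs
    linarith [mul_sub s (slope k i d) (slope k j d)]
  obtain ⟨s, hs⟩ := hev.exists
  exact ⟨_, fun i hi j hj => hs i hi j hj⟩

theorem not_isBounded_of_direction {d : ℝ × ℝ} (hd0 : d ≠ 0)
    (hd : ∀ i ∈ I, ∀ j ∉ I, slope k j d < slope k i d) :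
    ¬ Bornology.IsBounded (region k θ₀ t I) := by
  intro hb
  obtain ⟨p, hp⟩ := region_nonempty_of_direction (θ₀ := θ₀) (t := t) hd
  obtain ⟨R, hR⟩ := isBounded_iff_forall_norm_le.1 hb
  have hpos := norm_pos_iff.2 hd0
  have h0 : 0 ≤ R := (norm_nonneg p).trans (hR p hp)
  have h := hR _ (add_smul_mem_region hp hd
    (s := (2 * R + 1) / ‖d‖) (div_nonneg (by linarith) hpos.le))
  have h1 : ‖((2 * R + 1) / ‖d‖) • d‖ = 2 * R + 1 := by
    rw [norm_smul, Real.norm_of_nonneg (div_nonneg (by linarith) hpos.le),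
      div_mul_cancel₀ _ hpos.ne']
  have h2 := norm_sub_le (p + ((2 * R + 1) / ‖d‖) • d) p
  rw [add_sub_cancel_left, h1] at h2
  linarith [hR p hp]

theorem exists_down_direction_of_isContiguous (hk : StrictMono k) (hI : IsContiguous I) :
    ∃ u : ℝ, ∀ i ∈ I, ∀ j ∉ I, slope k j (u, -1) < slope k i (u, -1) := by
  obtain ⟨u, hu⟩ := exists_down_direction hk (P := I) (Q := Iᶜ) disjoint_compl_right
    fun i hi l hl j hj hij hjl => Finset.mem_compl.1 hj (hI i j l hij hjl hi hl)
  exact ⟨u, fun i hi j hj => hu i hi j (Finset.mem_compl.2 hj)⟩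

theorem exists_up_direction_of_isContiguous_compl (hk : StrictMono k) (hI : IsContiguous Iᶜ) :
    ∃ u : ℝ, ∀ i ∈ I, ∀ j ∉ I, slope k j (u, 1) < slope k i (u, 1) := by
  obtain ⟨u, hu⟩ := exists_up_direction hk (P := I) (Q := Iᶜ) disjoint_compl_right
    fun i hi l hl j hj hij hjl => Finset.mem_compl.1 (hI i j l hij hjl hi hl) hj
  exact ⟨u, fun i hi j hj => hu i hi j (Finset.mem_compl.2 hj)⟩

theorem exists_recession_of_not_isBounded {A : Set (ℝ × ℝ)} (hA : A ⊆ closedRegion k θ₀ t I)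
    (hb : ¬ Bornology.IsBounded A) : ∃ d : ℝ × ℝ, d ≠ 0 ∧
      (∀ i ∈ I, ∀ j ∉ I, slope k j d ≤ slope k i d) ∧
      ∀ y, (∀ p ∈ A, p.2 ≤ y) → d.2 ≤ 0 := by
  obtain ⟨d, hd0, hd⟩ := exists_recession_direction hb
  refine ⟨d, hd0, fun i hi j hj => ?_, fun y hy => ?_⟩
  · have := hd (slope k i - slope k j) ((θ₀ j - k j ^ 3 * t) - (θ₀ i - k i ^ 3 * t))
      fun p hp => by
        have := hA hp i hi j hj
        rw [phase_eq_slope, phase_eq_slope] at this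
        rw [sub_apply]
        linarith
    rw [sub_apply] at this
    linarith
  · have := hd (-ContinuousLinearMap.snd ℝ ℝ ℝ) (-y) fun p hp => by
      simpa using hy p hp
    simpa using this

/-- Otherwise there would be a recession direction not pointing up, making `I` contiguous. The
boundedness gives regions with non-contiguous `I` a lowest point. -/
theorem isBounded_sublevel (hk : StrictMono k) (hI : ¬ IsContiguous I) (y : ℝ) :
    Bornology.IsBounded (closedRegion k θ₀ t I ∩ {p | p.2 ≤ y}) := by
  by_contra hb
  obtain ⟨d, hd0, hd, hy⟩ := exists_recession_of_not_isBounded Set.inter_subset_left hb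
  exact hI (isContiguous_of_direction hk hd0 (hy y fun p hp => hp.2) hd)

/-- A recession direction points weakly down or weakly up, and reversing it exchanges the roles of
`I` and `Iᶜ`. Conversely, contiguity of either set supplies a direction in which the region extends
to infinity. -/
theorem isBounded_region_iff (hk : StrictMono k) :
    Bornology.IsBounded (region k θ₀ t I) ↔ ¬ IsContiguous I ∧ ¬ IsContiguous Iᶜ := by
  constructor
  · intro hb
    refine ⟨fun hI => ?_, fun hI => ?_⟩
    · obtain ⟨u, hu⟩ := exists_down_direction_of_isContiguous hk hI
      exact not_isBounded_of_direction (fun e => by simpa using congrArg Prod.snd e) hu hb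
    · obtain ⟨u, hu⟩ := exists_up_direction_of_isContiguous_compl hk hI
      exact not_isBounded_of_direction (fun e => by simpa using congrArg Prod.snd e) hu hb
  · rintro ⟨h1, h2⟩
    by_contra hb
    obtain ⟨d, hd0, hd, -⟩ := exists_recession_of_not_isBounded (region_subset_closedRegion I) hb
    rcases le_total d.2 0 with h | h
    · exact h1 (isContiguous_of_direction hk hd0 h hd)
    · refine h2 (isContiguous_of_direction hk (neg_ne_zero.2 hd0) (by simpa using h) ?_)
      intro i hi j hj
      rw [map_neg, map_neg, neg_le_neg_iff]
      exact hd j (by simpa using hj) i (by simpa using hi)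

end Region

/-! ### Lowest points of regions and the vertices where regions are born -/

section Birth

variable {N M : ℕ} {k θ₀ : Fin N → ℝ} {t : ℝ}

/-- The index set whose region is born (in the upward direction) at the vertex of the triple. -/
def birthSet (k θ₀ : Fin N → ℝ) (t : ℝ) (T : Fin N × Fin N × Fin N) : Finset (Fin N) :=
  above k θ₀ t (vertex k θ₀ t T.1 T.2.1 T.2.2) (vertexValue k θ₀ t T.1 T.2.1 T.2.2) ∪ {T.1, T.2.2}

/-- The weights eliminate `x`, leaving an affine function of `y` that vanishes at the vertex. For `i
< j < l` the weights are positive, which gives the lower bound on the height. -/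
theorem weighted_phase_sub (hk : Function.Injective k) {i j l : Fin N} (hij : i ≠ j) (hil : i ≠ l)
    (hjl : j ≠ l) (p : ℝ × ℝ) :
    (k l - k j) * (phase k θ₀ t p i - phase k θ₀ t p j) +
      (k j - k i) * (phase k θ₀ t p l - phase k θ₀ t p j) =
    (k j - k i) * (k l - k i) * (k l - k j) * (p.2 - (vertex k θ₀ t i j l).2) := by
  have h1 : k i - k j ≠ 0 := sub_ne_zero.2 (hk.ne hij)
  have h2 : k i - k l ≠ 0 := sub_ne_zero.2 (hk.ne hil)
  have h3 : k j - k l ≠ 0 := sub_ne_zero.2 (hk.ne hjl)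
  simp only [vertex, secondDiff, phase]
  rw [← neg_sub (k i) (k j), ← neg_sub (k i) (k l), ← neg_sub (k j) (k l)]
  field_simp
  ring

/-- Where the outer two of three phases exceed the middle one, the vertex is the unique lowest
point. -/
theorem vertex_snd_le (hk : StrictMono k) {i j l : Fin N} (hij : i < j) (hjl : j < l) {p : ℝ × ℝ}
    (h1 : phase k θ₀ t p j ≤ phase k θ₀ t p i) (h2 : phase k θ₀ t p j ≤ phase k θ₀ t p l) :
    (vertex k θ₀ t i j l).2 ≤ p.2 ∧ (p.2 ≤ (vertex k θ₀ t i j l).2 → p = vertex k θ₀ t i j l) := by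
  have hil := hij.trans hjl
  have e := weighted_phase_sub (θ₀ := θ₀) (t := t) hk.injective hij.ne hil.ne hjl.ne p
  have a1 := sub_pos.2 (hk hij)
  have a2 := sub_pos.2 (hk hil)
  have a3 := sub_pos.2 (hk hjl)
  have b1 := mul_nonneg a3.le (sub_nonneg.2 h1)
  have b2 := mul_nonneg a1.le (sub_nonneg.2 h2)
  have a4 := mul_pos (mul_pos a1 a2) a3
  have hle : (vertex k θ₀ t i j l).2 ≤ p.2 := by
    refine sub_nonneg.1 (nonneg_of_mul_nonneg_right (a := (k j - k i) * (k l - k i) * (k l - k j))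
      ?_ a4)
    linarith
  refine ⟨hle, fun hge => ?_⟩
  rw [le_antisymm hge hle, sub_self, mul_zero] at e
  have c1 : (k l - k j) * (phase k θ₀ t p i - phase k θ₀ t p j) = 0 := by linarith
  have c2 : (k j - k i) * (phase k θ₀ t p l - phase k θ₀ t p j) = 0 := by linarith
  rw [mul_eq_zero, or_iff_right a3.ne'] at c1
  rw [mul_eq_zero, or_iff_right a1.ne'] at c2
  exact eq_vertex hk.injective hij.ne hil.ne hjl.ne (by linarith) (by linarith)

theorem triple_subset_level (hk : StrictMono k) {i j l : Fin N} (hij : i < j) (hjl : j < l) :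
    ({i, j, l} : Finset (Fin N)) ⊆
      level k θ₀ t (vertex k θ₀ t i j l) (vertexValue k θ₀ t i j l) := by
  have hil := hij.trans hjl
  intro m hm
  simp only [Finset.mem_insert, Finset.mem_singleton] at hm
  rw [mem_level, vertexValue]
  rcases hm with rfl | rfl | rfl
  · rfl
  · exact (phase_vertex_snd hk.injective hij.ne l).symm
  · exact phase_vertex_thd hk.injective hij.ne hil.ne hjl.ne

theorem card_triple {i j l : Fin N} (hij : i < j) (hjl : j < l) :
    ({i, j, l} : Finset (Fin N)).card = 3 :=
  Finset.card_eq_three.2 ⟨i, j, l, hij.ne, (hij.trans hjl).ne, hjl.ne, rfl⟩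

/-- In the generic situation exactly the three given phases meet at a birth vertex. -/
theorem level_eq_triple (hk : StrictMono k) {d : ℕ} (hgen : IsGeneric (d + 2) k θ₀ t)
    {i j l : Fin N} (hij : i < j) (hjl : j < l) (hd : vertexDepth k θ₀ t i j l = d) :
    level k θ₀ t (vertex k θ₀ t i j l) (vertexValue k θ₀ t i j l) = {i, j, l} := by
  have hsub := triple_subset_level (θ₀ := θ₀) (t := t) hk hij hjl
  have hc := Finset.card_le_card hsub
  rw [card_triple hij hjl] at hc
  change (above k θ₀ t (vertex k θ₀ t i j l) (vertexValue k θ₀ t i j l)).card = d at hd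
  refine (Finset.eq_of_subset_of_card_le hsub ?_).symm
  rw [card_triple hij hjl]
  exact hgen.card_level_le _ (by omega) (by omega)

/-- The sets with nonempty region that are not contiguous; their regions are those with a lowest
point. -/
def bornSets (M : ℕ) (k θ₀ : Fin N → ℝ) (t : ℝ) : Set (Finset (Fin N)) :=
  {I | I.card = M ∧ (region k θ₀ t I).Nonempty ∧ ¬ IsContiguous I}

theorem vertex_mem_closedRegion_birthSet (hk : StrictMono k) {d : ℕ}
    {i j l : Fin N} (hij : i < j) (hjl : j < l)
    (hd : vertexDepth k θ₀ t i j l = d) :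
    (birthSet k θ₀ t (i, j, l)).card = d + 2 ∧
    vertex k θ₀ t i j l ∈ closedRegion k θ₀ t (birthSet k θ₀ t (i, j, l)) := by
  have hil := hij.trans hjl
  have hsub := triple_subset_level (θ₀ := θ₀) (t := t) hk hij hjl
  have hc := Finset.card_le_card hsub
  rw [card_triple hij hjl] at hc
  have hcard : (birthSet k θ₀ t (i, j, l)).card = d + 2 := by
    unfold birthSet
    rw [Finset.card_union_of_disjoint, Finset.card_pair hil.ne]
    · exact congrArg (· + 2) hd
    · refine (disjoint_above_level _).mono_right (Finset.Subset.trans ?_ hsub)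
      intro m hm
      simp only [Finset.mem_insert, Finset.mem_singleton] at hm ⊢
      tauto
  have hd' : (above k θ₀ t (vertex k θ₀ t i j l) (vertexValue k θ₀ t i j l)).card = d := hd
  have hdom : birthSet k θ₀ t (i, j, l) ∈ dominant (d + 2) k θ₀ t (vertex k θ₀ t i j l) := by
    rw [mem_dominant_iff_of_level (v := vertexValue k θ₀ t i j l) (by omega) (by omega)]
    refine ⟨hcard, Finset.subset_union_left, Finset.union_subset_union_right ?_⟩
    refine Finset.Subset.trans ?_ hsub
    intro m hm
    simp only [Finset.mem_insert, Finset.mem_singleton] at hm ⊢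
    tauto
  exact ⟨hcard, (mem_dominant_iff.1 hdom).2⟩

theorem birthSet_mem_and_notMem (hk : StrictMono k) {i j l : Fin N} (hij : i < j) (hjl : j < l) :
    i ∈ birthSet k θ₀ t (i, j, l) ∧ l ∈ birthSet k θ₀ t (i, j, l) ∧
      j ∉ birthSet k θ₀ t (i, j, l) := by
  have hj : j ∈ level k θ₀ t (vertex k θ₀ t i j l) (vertexValue k θ₀ t i j l) :=
    triple_subset_level hk hij hjl (by simp)
  refine ⟨by simp [birthSet], by simp [birthSet], ?_⟩
  simp only [birthSet, Finset.mem_union, Finset.mem_insert, Finset.mem_singleton, not_or]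
  exact ⟨fun h => Finset.disjoint_left.1 (disjoint_above_level _) h hj, hij.ne', hjl.ne⟩

theorem birthSet_mapsTo (hk : StrictMono k) {d : ℕ} (hgen : IsGeneric (d + 2) k θ₀ t) :
    Set.MapsTo (birthSet k θ₀ t) (triplesOfDepth k θ₀ t d) (bornSets (d + 2) k θ₀ t) := by
  rintro ⟨i, j, l⟩ hT
  simp only [triplesOfDepth, Finset.coe_filter, Finset.mem_univ, true_and,
    Set.mem_ofPred_eq] at hT
  obtain ⟨hij, hjl, hd⟩ := hT
  obtain ⟨hcard, hV⟩ := vertex_mem_closedRegion_birthSet hk hij hjl hd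
  obtain ⟨hi, hl, hj⟩ := birthSet_mem_and_notMem (θ₀ := θ₀) (t := t) hk hij hjl
  refine ⟨hcard, ?_, fun hcon => hj (hcon i j l hij hjl hi hl)⟩
  obtain ⟨u, hu⟩ := exists_up_direction hk (P := {i, l}) (Q := {j})
    (by simp [hij.ne', hjl.ne]) (by
      intro a ha b hb c _ hac hcb
      rw [Finset.mem_singleton] at ha hb
      subst ha; subst hb
      exact lt_asymm hac hcb)
  -- By genericity, a member can tie with a non-member only inside the triple, hence only `i` or `l`
  -- with `j`; the upward direction separates these ties.
  obtain ⟨ε, -, hε⟩ := exists_add_smul_mem_region hV (d := (u, 1)) fun a ha b hb hab => by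
    set V := vertex k θ₀ t i j l
    set v := vertexValue k θ₀ t i j l
    have hlev : level k θ₀ t V v = {i, j, l} := level_eq_triple hk hgen hij hjl hd
    have hav : v ≤ phase k θ₀ t V a := by
      rw [birthSet, Finset.mem_union] at ha
      rcases ha with ha | ha
      · exact (mem_above.1 ha).le
      · refine (mem_level.1 (triple_subset_level hk hij hjl ?_)).ge
        simp only [Finset.mem_insert, Finset.mem_singleton] at ha ⊢
        tauto
    have hbv : phase k θ₀ t V b ≤ v := by
      by_contra hlt
      exact hb (Finset.mem_union_left _ (mem_above.2 (not_le.1 hlt)))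
    have hbv' : phase k θ₀ t V b = v := le_antisymm hbv (hab ▸ hav)
    have hav' : phase k θ₀ t V a = v := hab ▸ hbv'
    have hbl : b ∈ level k θ₀ t V v := mem_level.2 hbv'
    have hal : a ∈ level k θ₀ t V v := mem_level.2 hav'
    rw [hlev] at hal hbl
    simp only [Finset.mem_insert, Finset.mem_singleton] at hal hbl
    refine hu a ?_ b ?_
    · simp only [Finset.mem_insert, Finset.mem_singleton]
      rcases hal with h | h | h
      · exact Or.inl h
      · exact absurd (h ▸ ha) hj
      · exact Or.inr h
    · rw [Finset.mem_singleton]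
      rcases hbl with h | h | h
      · exact absurd (h ▸ hi) hb
      · exact h
      · exact absurd (h ▸ hl) hb
  exact ⟨_, hε⟩

/-- The vertex is recovered as the unique lowest point of the closed region, and the triple as the
set of phases tied there. -/
theorem birthSet_injOn (hk : StrictMono k) {d : ℕ} (hgen : IsGeneric (d + 2) k θ₀ t) :
    Set.InjOn (birthSet k θ₀ t) (triplesOfDepth k θ₀ t d) := by
  rintro ⟨i, j, l⟩ hT ⟨i', j', l'⟩ hT' he
  simp only [triplesOfDepth, Finset.coe_filter, Finset.mem_univ, true_and,
    Set.mem_ofPred_eq] at hT hT'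
  obtain ⟨hij, hjl, hd⟩ := hT
  obtain ⟨hij', hjl', hd'⟩ := hT'
  obtain ⟨-, hV⟩ := vertex_mem_closedRegion_birthSet hk hij hjl hd
  obtain ⟨-, hV'⟩ := vertex_mem_closedRegion_birthSet hk hij' hjl' hd'
  obtain ⟨hi, hl, hj⟩ := birthSet_mem_and_notMem (θ₀ := θ₀) (t := t) hk hij hjl
  obtain ⟨hi', hl', hj'⟩ := birthSet_mem_and_notMem (θ₀ := θ₀) (t := t) hk hij' hjl'
  have h1 := vertex_snd_le hk hij hjl ((he ▸ hV') i hi j hj) ((he ▸ hV') l hl j hj)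
  have h2 := vertex_snd_le hk hij' hjl' ((he ▸ hV) i' hi' j' hj') ((he ▸ hV) l' hl' j' hj')
  have hVV : vertex k θ₀ t i' j' l' = vertex k θ₀ t i j l := h1.2 h2.1
  have hge : ∀ {a b c : Fin N}, a < b → b < c → ∀ m ∈ birthSet k θ₀ t (a, b, c),
      vertexValue k θ₀ t a b c ≤ phase k θ₀ t (vertex k θ₀ t a b c) m := by
    intro a b c hab hbc m hm
    rw [birthSet, Finset.mem_union] at hm
    rcases hm with hm | hm
    · exact (mem_above.1 hm).le
    · refine (mem_level.1 (triple_subset_level hk hab hbc ?_)).ge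
      simp only [Finset.mem_insert, Finset.mem_singleton] at hm ⊢
      tauto
  have hvv : vertexValue k θ₀ t i' j' l' = vertexValue k θ₀ t i j l := by
    refine le_antisymm ?_ ?_
    · have := hge hij' hjl' i (he ▸ hi)
      rwa [hVV] at this
    · have := hge hij hjl i' (he ▸ hi')
      rwa [← hVV] at this
  have hlev := level_eq_triple hk hgen hij hjl hd
  have hlev' := level_eq_triple hk hgen hij' hjl' hd'
  rw [hVV, hvv, hlev] at hlev'
  have hmem : ∀ m, (m = i ∨ m = j ∨ m = l) ↔ (m = i' ∨ m = j' ∨ m = l') := fun m => by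
    have := Finset.ext_iff.1 hlev' m
    simpa using this
  have m1 := (hmem i).1 (by simp)
  have m2 := (hmem j).1 (by simp)
  have m3 := (hmem l).1 (by simp)
  have : i = i' ∧ j = j' ∧ l = l' := by omega
  rw [this.1, this.2.1, this.2.2]

/-- The lowest point of a region bounded below is a vertex at which the region is born. -/
theorem exists_triple_of_mem_bornSets (hk : StrictMono k) (hM : 0 < M) (hMN : M ≤ N)
    (hgen : IsGeneric M k θ₀ t) {I : Finset (Fin N)} (hI : I ∈ bornSets M k θ₀ t) :
    ∃ i j l, i < j ∧ j < l ∧ vertexDepth k θ₀ t i j l + 2 = M ∧ birthSet k θ₀ t (i, j, l) = I := by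
  obtain ⟨hcard, ⟨p₀, hp₀⟩, hcont⟩ := hI
  have hcomp : IsCompact (closedRegion k θ₀ t I ∩ {p | p.2 ≤ p₀.2}) :=
    Metric.isCompact_of_isClosed_isBounded ((isClosed_closedRegion k θ₀ t I).inter
      (isClosed_le continuous_snd continuous_const)) (isBounded_sublevel hk hcont _)
  obtain ⟨V, hV, hmin⟩ := hcomp.exists_isMinOn
    ⟨p₀, region_subset_closedRegion I hp₀, le_refl p₀.2⟩ continuous_snd.continuousOn
  have hlow : ∀ q ∈ closedRegion k θ₀ t I, V.2 ≤ q.2 := by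
    intro q hq
    rcases le_total q.2 p₀.2 with h | h
    · exact hmin ⟨hq, h⟩
    · exact le_trans hV.2 h
  obtain ⟨v, hv1, hv2⟩ := exists_level hM hMN k θ₀ t V
  obtain ⟨-, hA, hB⟩ := (mem_dominant_iff_of_level hv1 hv2).1 (mem_dominant_iff.2 ⟨hcard, hV.1⟩)
  have htie : ∀ a ∈ I, ∀ b ∉ I, phase k θ₀ t V b = phase k θ₀ t V a →
      a ∈ level k θ₀ t V v ∧ b ∈ level k θ₀ t V v := by
    intro a ha b hb hab
    have hbv : phase k θ₀ t V b ≤ v := by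
      by_contra hlt
      exact hb (hA (mem_above.2 (not_le.1 hlt)))
    have hav : v ≤ phase k θ₀ t V a := by
      have := hB ha
      rw [Finset.mem_union, mem_above, mem_level] at this
      rcases this with h | h
      · exact h.le
      · exact h.ge
    have hbv' : phase k θ₀ t V b = v := le_antisymm hbv (hab ▸ hav)
    exact ⟨mem_level.2 (hab ▸ hbv'), mem_level.2 hbv'⟩
  -- If no tied non-member lay between two tied members, some downward direction would separate the
  -- ties and lead to a point of the region below its minimum.
  obtain ⟨i, j, l, hij, hjl, hi, hl, hj, hjI⟩ : ∃ i j l, i < j ∧ j < l ∧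
      i ∈ I ∩ level k θ₀ t V v ∧ l ∈ I ∩ level k θ₀ t V v ∧ j ∈ level k θ₀ t V v ∧ j ∉ I := by
    by_contra hcon
    obtain ⟨u, hu⟩ := exists_down_direction hk (P := I ∩ level k θ₀ t V v)
      (Q := level k θ₀ t V v \ I)
      (Finset.disjoint_left.2 fun m hm hm' =>
        (Finset.mem_sdiff.1 hm').2 (Finset.mem_inter.1 hm).1)
      fun a ha c hc b hb hab hbc => hcon ⟨a, b, c, hab, hbc, ha, hc,
        (Finset.mem_sdiff.1 hb).1, (Finset.mem_sdiff.1 hb).2⟩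
    obtain ⟨ε, hε, hmem⟩ := exists_add_smul_mem_region hV.1 (d := (u, -1))
      fun a ha b hb hab => hu a (Finset.mem_inter.2 ⟨ha, (htie a ha b hb hab).1⟩) b
        (Finset.mem_sdiff.2 ⟨(htie a ha b hb hab).2, hb⟩)
    have := hlow _ (region_subset_closedRegion I hmem)
    simp only [Prod.snd_add, Prod.smul_snd, smul_eq_mul] at this
    linarith
  have hil := hij.trans hjl
  rw [Finset.mem_inter] at hi hl
  have hsub : ({i, j, l} : Finset (Fin N)) ⊆ level k θ₀ t V v := by
    intro m hm
    simp only [Finset.mem_insert, Finset.mem_singleton] at hm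
    rcases hm with rfl | rfl | rfl
    exacts [hi.2, hj, hl.2]
  have hlt : M < (above k θ₀ t V v).card + (level k θ₀ t V v).card := by
    rw [← hcard, ← Finset.card_union_of_disjoint (disjoint_above_level v)]
    exact Finset.card_lt_card ⟨hB, fun h => hjI (h (Finset.mem_union_right _ hj))⟩
  have hlev : ({i, j, l} : Finset (Fin N)) = level k θ₀ t V v := by
    refine Finset.eq_of_subset_of_card_le hsub ?_
    rw [card_triple hij hjl]
    exact hgen.card_level_le V hv1 hlt
  have hiv := mem_level.1 hi.2
  have hVe : V = vertex k θ₀ t i j l := eq_vertex hk.injective hij.ne hil.ne hjl.ne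
    (hiv.trans (mem_level.1 hj).symm) (hiv.trans (mem_level.1 hl.2).symm)
  have hve : vertexValue k θ₀ t i j l = v := by rw [vertexValue, ← hVe, hiv]
  have hIe : birthSet k θ₀ t (i, j, l) = I := by
    ext m
    simp only [birthSet, ← hVe, hve, Finset.mem_union, Finset.mem_insert, Finset.mem_singleton]
    constructor
    · rintro (h | rfl | rfl)
      exacts [hA h, hi.1, hl.1]
    · intro hm
      rcases Finset.mem_union.1 (hB hm) with h | h
      · exact Or.inl h
      · rw [← hlev] at h
        simp only [Finset.mem_insert, Finset.mem_singleton] at h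
        rcases h with h | h | h
        · exact Or.inr (Or.inl h)
        · exact absurd (h ▸ hm) hjI
        · exact Or.inr (Or.inr h)
  refine ⟨i, j, l, hij, hjl, ?_, hIe⟩
  rw [← (vertex_mem_closedRegion_birthSet (θ₀ := θ₀) (t := t) hk hij hjl rfl).1, hIe, hcard]

theorem encard_bornSets (hk : StrictMono k) (D d : ℕ) (hN : N = D + (d + 2))
    (hgen : IsGeneric (d + 2) k θ₀ t) :
    (bornSets (d + 2) k θ₀ t).encard = ((d + 1) * D : ℕ) := by
  have himage : birthSet k θ₀ t '' (triplesOfDepth k θ₀ t d) = bornSets (d + 2) k θ₀ t := by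
    refine Set.Subset.antisymm (birthSet_mapsTo hk hgen).image_subset fun I hI => ?_
    obtain ⟨i, j, l, hij, hjl, hd, he⟩ :=
      exists_triple_of_mem_bornSets hk (by omega) (by omega) hgen hI
    refine ⟨(i, j, l), ?_, he⟩
    simp only [triplesOfDepth, Finset.coe_filter, Finset.mem_univ, true_and, Set.mem_ofPred_eq]
    exact ⟨hij, hjl, by omega⟩
  rw [← himage, (birthSet_injOn hk hgen).encard_image, Set.encard_coe_eq_coe_finsetCard,
    card_triplesOfDepth hk D d hN hgen]

end Birth

/-! ### Counting sets with contiguous complement -/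

section Contiguous

variable {N : ℕ}

/-- The block of `D` consecutive indices starting at `a`. -/
def block (N D a : ℕ) : Finset (Fin N) := Finset.univ.filter fun i => a ≤ (i : ℕ) ∧ (i : ℕ) < a + D

theorem mem_block {D a : ℕ} {i : Fin N} : i ∈ block N D a ↔ a ≤ (i : ℕ) ∧ (i : ℕ) < a + D := by
  simp [block]

theorem card_block {D a : ℕ} (h : a + D ≤ N) : (block N D a).card = D := by
  have : (block N D a).map Fin.valEmbedding = Finset.Ico a (a + D) := by
    ext n
    simp only [Finset.mem_map, mem_block, Fin.valEmbedding_apply, Finset.mem_Ico]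
    constructor
    · rintro ⟨i, hi, rfl⟩; exact hi
    · intro hn; exact ⟨⟨n, by omega⟩, hn, rfl⟩
  rw [← Finset.card_map Fin.valEmbedding, this, Nat.card_Ico, Nat.add_sub_cancel_left]

theorem IsContiguous.exists_eq_block {J : Finset (Fin N)} (hJ : IsContiguous J) (hne : J.Nonempty) :
    ∃ a, a + J.card ≤ N ∧ J = block N J.card a := by
  have e : J = Finset.Icc (J.min' hne) (J.max' hne) := by
    ext m
    rw [Finset.mem_Icc]
    refine ⟨fun hm => ⟨J.min'_le m hm, J.le_max' m hm⟩, fun hm => ?_⟩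
    rcases hm.1.eq_or_lt with h | h
    · exact h ▸ J.min'_mem hne
    rcases hm.2.eq_or_lt with h' | h'
    · exact h' ▸ J.max'_mem hne
    exact hJ _ m _ h h' (J.min'_mem hne) (J.max'_mem hne)
  have hle : J.min' hne ≤ J.max' hne := J.min'_le _ (J.max'_mem hne)
  have hc : J.card = (J.max' hne : ℕ) + 1 - (J.min' hne : ℕ) := by
    conv_lhs => rw [e]
    rw [Fin.card_Icc]
  refine ⟨J.min' hne, by omega, ?_⟩
  rw [hc]
  conv_lhs => rw [e]
  ext m
  rw [Finset.mem_Icc, mem_block]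
  omega

/-- The non-contiguous sets with contiguous complement of size `D`. -/
theorem encard_contiguous_compl (D d : ℕ) (hN : N = D + (d + 2)) (hD : 0 < D) :
    {I : Finset (Fin N) | I.card = d + 2 ∧ ¬ IsContiguous I ∧ IsContiguous Iᶜ}.encard =
      (d + 1 : ℕ) := by
  -- Blocks touching either end are left out, since their complements are contiguous: the start `a +
  -- 1` avoids the first index, and `a ≤ d` avoids the last.
  have himage : (fun a => (block N D (a + 1))ᶜ) '' (Finset.range (d + 1)) =
      {I : Finset (Fin N) | I.card = d + 2 ∧ ¬ IsContiguous I ∧ IsContiguous Iᶜ} := by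
    ext I
    simp only [Set.mem_image, Finset.coe_range, Set.mem_Iio, Set.mem_ofPred_eq]
    constructor
    · rintro ⟨a, ha, rfl⟩
      refine ⟨?_, fun h => ?_, ?_⟩
      · rw [Finset.card_compl, card_block (by omega), Fintype.card_fin]; omega
      · have := h ⟨0, by omega⟩ ⟨a + 1, by omega⟩ ⟨N - 1, by omega⟩
          (by rw [Fin.lt_def]; simp) (by rw [Fin.lt_def]; simp only; omega)
          (by rw [Finset.mem_compl, mem_block]; simp)
          (by rw [Finset.mem_compl, mem_block]; simp only; omega)
        rw [Finset.mem_compl, mem_block] at this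
        simp only at this
        omega
      · rw [compl_compl]
        intro i j l hij hjl hi hl
        rw [mem_block] at hi hl ⊢
        omega
    · rintro ⟨hc, h1, h2⟩
      have hcc : Iᶜ.card = D := by rw [Finset.card_compl, Fintype.card_fin]; omega
      obtain ⟨a, ha, he⟩ := h2.exists_eq_block (Finset.card_pos.1 (by omega))
      rw [hcc] at ha he
      have hI : I = (block N D a)ᶜ := by rw [← he, compl_compl]
      have hmem : ∀ m, m ∈ I ↔ ¬ (a ≤ (m : ℕ) ∧ (m : ℕ) < a + D) := fun m => by
        rw [hI, Finset.mem_compl, mem_block]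
      have ha0 : a ≠ 0 := fun h0 => h1 fun i j l hij hjl hi hl => by
        rw [hmem] at hi hl ⊢; omega
      have haM : a ≠ d + 2 := fun h0 => h1 fun i j l hij hjl hi hl => by
        rw [hmem] at hi hl ⊢; omega
      refine ⟨a - 1, by omega, ?_⟩
      rw [show a - 1 + 1 = a by omega, hI]
  rw [← himage, Set.InjOn.encard_image, Set.encard_coe_eq_coe_finsetCard, Finset.card_range]
  intro a ha b hb hab
  simp only [Finset.coe_range, Set.mem_Iio] at ha hb
  have he := compl_injective hab
  have h1 : (⟨a + 1, by omega⟩ : Fin N) ∈ block N D (b + 1) := by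
    rw [← he, mem_block]; simp only; omega
  have h2 : (⟨b + 1, by omega⟩ : Fin N) ∈ block N D (a + 1) := by
    rw [he, mem_block]; simp only; omega
  rw [mem_block] at h1 h2
  simp only at h1 h2
  omega

end Contiguous

/-! ### Connected components of the complement and the number of holes -/

section Holes

variable {N M : ℕ} {k θ₀ : Fin N → ℝ} {t : ℝ}

theorem region_disjoint {I J : Finset (Fin N)} (hcard : I.card = J.card) {p : ℝ × ℝ}
    (hI : p ∈ region k θ₀ t I) (hJ : p ∈ closedRegion k θ₀ t J) : I = J := by
  by_contra hne
  obtain ⟨i, hiI, hiJ⟩ : ∃ i ∈ I, i ∉ J := by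
    by_contra hcon
    push Not at hcon
    exact hne (Finset.eq_of_subset_of_card_le hcon hcard.ge)
  obtain ⟨j, hjJ, hjI⟩ : ∃ j ∈ J, j ∉ I := by
    by_contra hcon
    push Not at hcon
    exact hne (Finset.eq_of_subset_of_card_le hcon hcard.le).symm
  exact (hI i hiI j hjI).not_ge (hJ j hjJ i hiJ)

/-- The complement of the graph is the union of the open regions. -/
theorem compl_graph (hM : M ≤ N) :
    (graph M k θ₀ t)ᶜ = ⋃ I ∈ {I : Finset (Fin N) | I.card = M}, region k θ₀ t I := by
  ext p
  simp only [Set.mem_iUnion, Set.mem_ofPred_eq, exists_prop]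
  change ¬ (dominant M k θ₀ t p).Nontrivial ↔ _
  rw [Set.not_nontrivial_iff]
  constructor
  · intro hs
    obtain ⟨I, hI⟩ := dominant_nonempty (k := k) (θ₀ := θ₀) (t := t) (p := p) hM
    refine ⟨I, hI.1, fun i hi j hj => ?_⟩
    refine lt_of_le_of_ne ((mem_dominant_iff.1 hI).2 i hi j hj) fun he => ?_
    have hI' : insert j (I.erase i) ∈ dominant M k θ₀ t p := by
      refine ⟨(card_insert_erase hi hj).trans hI.1, fun J hJ => ?_⟩
      rw [sum_insert_erase _ hi hj, he, sub_add_cancel]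
      exact hI.2 J hJ
    have := hs hI hI'
    exact hj (this ▸ Finset.mem_insert_self j _)
  · rintro ⟨I, hI, hp⟩ J hJ J' hJ'
    rw [mem_dominant_iff] at hJ hJ'
    rw [← region_disjoint (hI.trans hJ.1.symm) hp hJ.2,
      ← region_disjoint (hI.trans hJ'.1.symm) hp hJ'.2]

/-- The open regions are the connected components of the complement of the graph. -/
theorem connectedComponentIn_compl_graph (hM : M ≤ N) {I : Finset (Fin N)} (hI : I.card = M)
    {p : ℝ × ℝ} (hp : p ∈ region k θ₀ t I) :
    connectedComponentIn (graph M k θ₀ t)ᶜ p = region k θ₀ t I := by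
  have hsub : region k θ₀ t I ⊆ (graph M k θ₀ t)ᶜ := by
    rw [compl_graph hM]
    exact Set.subset_biUnion_of_mem (u := fun I => region k θ₀ t I)
      (show I ∈ {I : Finset (Fin N) | I.card = M} from hI)
  refine Set.Subset.antisymm ?_
    ((convex_region k θ₀ t I).isPreconnected.subset_connectedComponentIn hp hsub)
  set U := ⋃ J ∈ {J : Finset (Fin N) | J.card = M ∧ J ≠ I}, region k θ₀ t J with hU
  refine isPreconnected_connectedComponentIn.subset_left_of_subset_union
    (isOpen_region k θ₀ t I) (v := U)
    (isOpen_biUnion fun J _ => isOpen_region k θ₀ t J) ?_ ?_ ⟨p, ?_, hp⟩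
  · rw [Set.disjoint_left]
    intro q hq hqU
    simp only [hU, Set.mem_iUnion, Set.mem_ofPred_eq, exists_prop] at hqU
    obtain ⟨J, ⟨hJ, hne⟩, hqJ⟩ := hqU
    exact hne (region_disjoint (hJ.trans hI.symm) hqJ (region_subset_closedRegion I hq))
  · refine (connectedComponentIn_subset _ _).trans ?_
    rw [compl_graph hM]
    intro q hq
    simp only [Set.mem_iUnion, Set.mem_ofPred_eq, exists_prop] at hq
    obtain ⟨J, hJ, hqJ⟩ := hq
    by_cases he : J = I
    · exact Or.inl (he ▸ hqJ)
    · right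
      simp only [hU, Set.mem_iUnion, Set.mem_ofPred_eq, exists_prop]
      exact ⟨J, ⟨hJ, he⟩, hqJ⟩
  · exact mem_connectedComponentIn (hsub hp)

theorem holes_eq (hk : StrictMono k) (hM : M ≤ N) :
    holes (graph M k θ₀ t) =
      region k θ₀ t '' {I | I ∈ bornSets M k θ₀ t ∧ ¬ IsContiguous Iᶜ} := by
  ext C
  simp only [holes, Set.mem_ofPred_eq, Set.mem_image, bornSets]
  constructor
  · rintro ⟨⟨p, hp, rfl⟩, hb⟩
    rw [compl_graph hM] at hp
    simp only [Set.mem_iUnion, Set.mem_ofPred_eq, exists_prop] at hp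
    obtain ⟨I, hI, hpI⟩ := hp
    rw [connectedComponentIn_compl_graph hM hI hpI] at hb ⊢
    have := (isBounded_region_iff hk).1 hb
    exact ⟨I, ⟨⟨hI, ⟨p, hpI⟩, this.1⟩, this.2⟩, rfl⟩
  · rintro ⟨I, ⟨⟨hI, ⟨p, hpI⟩, h1⟩, h2⟩, rfl⟩
    refine ⟨⟨p, ?_, (connectedComponentIn_compl_graph hM hI hpI).symm⟩,
      (isBounded_region_iff hk).2 ⟨h1, h2⟩⟩
    rw [compl_graph hM]
    simp only [Set.mem_iUnion, Set.mem_ofPred_eq, exists_prop]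
    exact ⟨I, hI, hpI⟩

theorem encard_holes_eq (hk : StrictMono k) (hM : M ≤ N) :
    (holes (graph M k θ₀ t)).encard =
      {I | I ∈ bornSets M k θ₀ t ∧ ¬ IsContiguous Iᶜ}.encard := by
  rw [holes_eq hk hM, Set.InjOn.encard_image]
  rintro I ⟨⟨hI, ⟨p, hp⟩, -⟩, -⟩ J ⟨⟨hJ, -, -⟩, -⟩ he
  exact region_disjoint (hI.trans hJ.symm) hp (region_subset_closedRegion J (he ▸ hp))

/-- The number of holes in the generic situation. -/
theorem encard_holes (hk : StrictMono k) (D : ℕ) (hM : 0 < M) (hD : 0 < D) (hN : N = D + M)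
    (hgen : IsGeneric M k θ₀ t) :
    (holes (graph M k θ₀ t)).encard = ((D - 1) * (M - 1) : ℕ) := by
  rw [encard_holes_eq hk (by omega)]
  obtain ⟨D, rfl⟩ : ∃ D', D = D' + 1 := ⟨D - 1, by omega⟩
  rcases Nat.eq_or_lt_of_le (Nat.succ_le_of_lt hM) with h1 | h1
  -- For `M = 1` no region is born at a vertex, since the depth plus two would have to equal one.
  · have : {I | I ∈ bornSets M k θ₀ t ∧ ¬ IsContiguous Iᶜ} = ∅ := by
      rw [Set.eq_empty_iff_forall_notMem]
      rintro I ⟨hI, -⟩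
      obtain ⟨i, j, l, -, -, hd, -⟩ := exists_triple_of_mem_bornSets hk hM (by omega) hgen hI
      omega
    rw [this, ← h1]
    simp
  obtain ⟨d, rfl⟩ : ∃ d, M = d + 2 := ⟨M - 2, by omega⟩
  have hborn := encard_bornSets hk (D + 1) d hN hgen
  have hcont := encard_contiguous_compl (N := N) (D + 1) d hN (Nat.succ_pos D)
  -- Sets with contiguous complement always have a non-empty region, as it extends upwards to
  -- infinity. The number to subtract is therefore independent of `θ₀` and `t`.
  have hsplit : bornSets (d + 2) k θ₀ t =
      {I | I ∈ bornSets (d + 2) k θ₀ t ∧ ¬ IsContiguous Iᶜ} ∪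
      {I : Finset (Fin N) | I.card = d + 2 ∧ ¬ IsContiguous I ∧ IsContiguous Iᶜ} := by
    ext I
    simp only [Set.mem_union, Set.mem_ofPred_eq]
    constructor
    · intro hI
      by_cases hc : IsContiguous Iᶜ
      · exact Or.inr ⟨hI.1, hI.2.2, hc⟩
      · exact Or.inl ⟨hI, hc⟩
    · rintro (h | ⟨h1, h2, h3⟩)
      · exact h.1
      · obtain ⟨u, hu⟩ := exists_up_direction_of_isContiguous_compl hk h3
        exact ⟨h1, region_nonempty_of_direction hu, h2⟩
  have hdisj : Disjoint {I | I ∈ bornSets (d + 2) k θ₀ t ∧ ¬ IsContiguous Iᶜ}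
      {I : Finset (Fin N) | I.card = d + 2 ∧ ¬ IsContiguous I ∧ IsContiguous Iᶜ} :=
    Set.disjoint_left.2 fun I h h' => h.2 h'.2.2
  rw [hsplit, Set.encard_union_eq hdisj, hcont] at hborn
  have hfin : {I | I ∈ bornSets (d + 2) k θ₀ t ∧ ¬ IsContiguous Iᶜ}.Finite := Set.toFinite _
  rw [hfin.encard_eq_coe] at hborn ⊢
  norm_cast at hborn ⊢
  have e1 : D + 1 - 1 = D := rfl
  have e2 : d + 2 - 1 = d + 1 := rfl
  rw [e1, e2]
  linarith

end Holes

end KPSoliton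
end

theorem proposition1 (Nm Np : ℕ) (hm : 1 ≤ Nm) (hp : 1 ≤ Np)
    (k : Fin (Nm + Np) → ℝ) (hk : StrictMono k) :
    -- the graph is where the solution stays visible when everything is viewed on large scales
    (∀ (θ₀ : Fin (Nm + Np) → ℝ) (t : ℝ) (p : ℝ × ℝ),
      p ∈ KPSoliton.graph Np k θ₀ t ↔
        ¬ Filter.Tendsto (fun s : ℝ => KPSoliton.solution Np k (s • θ₀) (s * t) (s • p))
          Filter.atTop (𝓝 0)) ∧
    -- the situation is generic except at finitely many times
    (∀ θ₀ : Fin (Nm + Np) → ℝ, {t : ℝ | ¬ KPSoliton.IsGeneric Np k θ₀ t}.Finite) ∧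
    -- and, at a fixed time, for almost all phase constants
    (∀ t : ℝ, MeasureTheory.volume
      {θ₀ : Fin (Nm + Np) → ℝ | ¬ KPSoliton.IsGeneric Np k θ₀ t} = 0) ∧
    -- the number of holes in the generic situation
    (∀ (θ₀ : Fin (Nm + Np) → ℝ) (t : ℝ), KPSoliton.IsGeneric Np k θ₀ t →
      (KPSoliton.holes (KPSoliton.graph Np k θ₀ t)).encard =
        (((Nm - 1) * (Np - 1) : ℕ) : ℕ∞)) :=
  ⟨fun _ _ _ => KPSoliton.mem_graph_iff_not_tendsto (Nat.le_add_left _ _) hk.injective,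
    KPSoliton.finite_setOf_not_isGeneric hp (Nat.le_add_left _ _) hk.injective,
    KPSoliton.volume_setOf_not_isGeneric hp (Nat.le_add_left _ _) hk.injective,
    fun _ _ hgen => KPSoliton.encard_holes hk Nm hp hm rfl hgen⟩
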